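/- Let $F$ be a non-archimedean local field with absolute value $|\cdot|$ and uniformizer $\varpi$, let $|dt|$ be an additive Haar measure on $F$, and let $\psi:F\to\mathbb C^*$ be a non-trivial continuous (hence unitary) additive character. Let $\mathbf T\cong\mathbb G_m^d$ be a split torus over $F$, $T=\mathbf T(F)$, and let $\lambda_1,\dots,\lambda_n$ be cocharacters of $\mathbf T$, regarded as characters of the complex dual torus $\mathbf T^\vee$. Assume that $\rho=\bigoplus_{i=1}^n\lambda_i:\mathbf T^\vee\to GL(n,\mathbb C)$ is admissible, that is, $\ker\rho$ is connected and there is a character $\sigma$ of $\mathbf T$ which, as a cocharacter of $\mathbf T^\vee$, satisfies $\rho(\sigma(z))=z\cdot\mathrm{Id}$ for $z\in\mathbb C^*$; fix such a $\sigma$. Put $T_\rho=(F^*)^n$, $p_\rho:T_\rho\to T$, $p_\rho(t)=\prod_i\lambda_i(t_i)$, $f_\rho(t)=t_1+\dots+t_n$, $|\omega_\rho|=|dt_1\cdots dt_n|$ and $T_\rho(r)=\{t\in T_\rho:|f_\rho(t)|\le r\}$. A distribution $\Phi$ on $T$ is a linear functional on $C_c^\infty(T)$, the space of locally constant compactly supported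 functions. For $\phi\in C^\infty_c(T)$ write $(\Phi*\phi)(x)=\int\phi(h^{-1}x)\,d\Phi(h)$. If $f$ is a function on $T$ invariant under translation by some compact open subgroup, we say that $\int f\,d\Phi$ converges absolutely if the series $\sum_{hK\in T/K}f(h)\Phi(1_{hK})$ converges absolutely, with the same sum, for every compact open subgroup $K$ under which $f$ is invariant; that sum is the value of the integral. For a character $\chi$ of $F^*$ let $\gamma_\psi(\chi)=\int_{F^*}\chi(t)\psi(t)|dt|$, summed over the shells $|t|=|\varpi|^m$, $m\in\mathbb Z$, and for a (not necessarily unitary) character $\theta$ of $T$ let $\gamma_{\rho,T}(\theta)=\prod_{i=1}^n\gamma_\psi(\theta\circ\lambda_i)$. Then the following hold. 1. For every $r\ge 0$ and every compact open $C\subset T$ the integral $\Phi^r_\rho(C)=\int_{p_\rho^{-1}(C)\cap T_\rho(r)}\psi(f_\rho(t))\,|\omega_\rho|$ converges absolutely. 2. For every such $C$ the limit $\lim_{r\to\infty}\Phi_\rho^r(C)$ exists, and there is a unique distribution $\Phi_\rho$ on $T$ with $\Phi_\rho(1_C)=\lim_{r\to\infty}\Phi^r_\rho(C)$ for all compact open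 $C$. 3. For every character $\theta$ of $T$ and every $i$, there is a rational function $R_i$ over $\mathbb C$ such that $\gamma_\psi((\theta\circ\lambda_i)|\cdot|^s)$ converges and equals $R_i(|\varpi|^{s})$ whenever $|\varpi|^s$ is small enough. With $R=\prod_iR_i$, so that $\gamma_{\rho,T}(\theta|\sigma|^s)=R(|\varpi|^s)$ for $\mathrm{Re}\,s$ large, there is $s_0(\theta)\in\mathbb R$ such that for all $s\in\mathbb C$ with $\mathrm{Re}\,s>s_0(\theta)$ the distribution $\Phi_\rho$ acts on the function $\theta|\sigma|^s$ by the scalar $\gamma_{\rho,T}(\theta|\sigma|^s)$: for every $x\in T$, $$\int \theta(xh)|\sigma(xh)|^s\,d\Phi_\rho(h)=\gamma_{\rho,T}(\theta|\sigma|^s)\,\theta(x)|\sigma(x)|^s$$ with absolute convergence; equivalently, the convolution $\Phi_\rho*(\theta|\sigma|^s)^{-1}$, $x\mapsto\int(\theta|\sigma|^s)^{-1}(h^{-1}x)\,d\Phi_\rho(h)$, converges absolutely and equals $\gamma_{\rho,T}(\theta|\sigma|^s)\,(\theta|\sigma|^s)^{-1}$. 4. $\Phi_\rho$ is $\sigma$-regular.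 That is, let $\Phi_m$ be the product of $\Phi_\rho$ with the characteristic function of $\{x\in T:|\sigma(x)|=|\varpi|^m\}$. Then (a) each $\Phi_m$ is essentially compact: $\Phi_m*\phi\in C^\infty_c(T)$ for all $\phi\in C_c^\infty(T)$; (b) for every $\phi\in C_c^\infty(T)$ one has $\Phi_m*\phi=0$ for all sufficiently negative $m$; (c) on every connected component of the variety of characters of $T$, $\sum_mz^m\Phi_m$ is the Laurent expansion at $z=0$ of a rational function: for every character $\theta$ of $T$ there is a non-zero $P\in C_c^\infty(T)$ with $P(kx)=\theta(k)^{-1}P(x)$ for all $k$ in the maximal compact subgroup of $T$ and all $x\in T$, such that $\Phi_\rho*P\in C_c^\infty(T)$. -/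

import Mathlib

open MeasureTheory

noncomputable section

namespace SplitTorusGamma

/-! ### Split tori, their duals, and admissible representations -/

section Tori

/-- The group of `A`-points of the split torus of rank `d`. Its lattice of cocharacters and its
lattice of characters are both identified with `Fin d → ℤ`, the pairing being the dot product.
Taking `A = F` gives `T`; taking `A = ℂ` gives the dual torus, for which the roles of the two
lattices are exchanged. -/
abbrev Torus (A : Type*) [Field A] (d : ℕ) : Type _ := Fin d → Aˣ

/-- The one-parameter subgroup `x ↦ (x ^ l₁, …, x ^ l_d)` attached to `l : Fin d → ℤ`. -/
def cochar (A : Type*) [Field A] {d : ℕ} (l : Fin d → ℤ) : Aˣ →* Torus A d where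
  toFun x := fun j => x ^ l j
  map_one' := by funext j; simp
  map_mul' x y := by funext j; simp [mul_zpow]

/-- The character `x ↦ ∏ⱼ xⱼ ^ mⱼ` attached to `m : Fin d → ℤ`. -/
def char (A : Type*) [Field A] {d : ℕ} (m : Fin d → ℤ) : Torus A d →* Aˣ where
  toFun x := ∏ j, x j ^ m j
  map_one' := by simp
  map_mul' x y := by simp [mul_zpow, Finset.prod_mul_distrib]

variable {n d : ℕ}

/-- The representation `ρ = λ₁ ⊕ ⋯ ⊕ λₙ` of the dual torus `(ℂˣ)^d`: here the cocharacters `λᵢ`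
of `T` are viewed as characters of the dual torus. -/
def rep (lam : Fin n → Fin d → ℤ) : Torus ℂ d →* GL (Fin n) ℂ :=
  (Units.map (Matrix.diagonalRingHom (Fin n) ℂ : (Fin n → ℂ) →* Matrix (Fin n) (Fin n) ℂ)).comp
    ((MulEquiv.piUnits.symm : (Fin n → ℂˣ) ≃* (Fin n → ℂ)ˣ).toMonoidHom.comp
      (MonoidHom.pi fun i => char ℂ (lam i)))

theorem rep_apply (lam : Fin n → Fin d → ℤ) (z : Torus ℂ d) :
    ((rep lam z : GL (Fin n) ℂ) : Matrix (Fin n) (Fin n) ℂ)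
      = Matrix.diagonal fun i => ((char ℂ (lam i) z : ℂˣ) : ℂ) := rfl

/-- `ρ = ⊕ λᵢ` is admissible, with `sig` as the witnessing character `σ` of `T`: the kernel of `ρ`
is connected, and `ρ ∘ σ` is `z ↦ z • 1` when `σ` is viewed as a cocharacter of the dual torus. -/
structure IsAdmissible (lam : Fin n → Fin d → ℤ) (sig : Fin d → ℤ) : Prop where
  ker_connected : IsConnected ((rep lam).ker : Set (Torus ℂ d))
  rep_sig : ∀ z : ℂˣ,
    ((rep lam (cochar ℂ sig z) : GL (Fin n) ℂ) : Matrix (Fin n) (Fin n) ℂ)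
      = (z : ℂ) • (1 : Matrix (Fin n) (Fin n) ℂ)

/-- The homomorphism `p_ρ : T_ρ = (Fˣ)ⁿ → T`, `t ↦ ∏ᵢ λᵢ(tᵢ)`. -/
def pRho (F : Type*) [Field F] (lam : Fin n → Fin d → ℤ) : Torus F n →* Torus F d where
  toFun t := ∏ i, cochar F (lam i) (t i)
  map_one' := by simp
  map_mul' x y := by simp [Finset.prod_mul_distrib]

/-- The function `f_ρ(t) = t₁ + ⋯ + tₙ` on `T_ρ`. -/
def fRho {F : Type*} [Field F] (t : Torus F n) : F := ∑ i, (t i : F)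

end Tori

/-! ### Test functions, distributions and convolution on a totally disconnected group -/

section Distributions

variable (T : Type*) [CommGroup T] [TopologicalSpace T]

/-- The space of locally constant compactly supported complex functions on `T`. -/
def Test : Submodule ℂ (T → ℂ) where
  carrier := {φ | IsLocallyConstant φ ∧ HasCompactSupport φ}
  zero_mem' := ⟨IsLocallyConstant.const 0, HasCompactSupport.zero⟩
  add_mem' := fun ha hb => ⟨ha.1.add hb.1, ha.2.add hb.2⟩
  smul_mem' := fun c _ hφ => ⟨hφ.1.comp (fun x => c • x), hφ.2.smul_left (f := fun _ => c)⟩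

/-- Distributions on `T`: arbitrary linear functionals on the space of test functions. -/
abbrev Distribution : Type _ := Test T →ₗ[ℂ] ℂ

variable {T}

/-- Multiplication of test functions by the characteristic function of a clopen set. -/
def Test.restrict (U : Set T) (hU : IsClopen U) : Test T →ₗ[ℂ] Test T where
  toFun φ := ⟨U.indicator φ.1, by
    refine ⟨?_, ?_⟩
    · rw [IsLocallyConstant.iff_eventually_eq]
      intro x
      by_cases hx : x ∈ U
      · filter_upwards [hU.isOpen.mem_nhds hx, φ.2.1.eventually_eq x] with y hy h
        simp [hx, hy, h]
      · filter_upwards [hU.compl.isOpen.mem_nhds hx] with y hy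
        simp [hx, Set.indicator_of_notMem hy]
    · exact φ.2.2.mono (by
        intro x hx
        rw [Function.mem_support] at hx ⊢
        intro h
        apply hx
        simp [h])⟩
  map_add' φ φ' := by
    apply Subtype.ext
    exact Set.indicator_add U φ.1 φ'.1
  map_smul' c φ := by
    apply Subtype.ext
    exact Set.indicator_const_smul U c φ.1

/-- The characteristic function of a compact open set. -/
def Test.char [T2Space T] (C : Set T) (ho : IsOpen C) (hc : IsCompact C) : Test T :=
  ⟨C.indicator 1, by
    have hC : IsClopen C := ⟨hc.isClosed, ho⟩
    refine ⟨?_, ?_⟩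
    · rw [← LocallyConstant.coe_charFn ℂ hC]
      exact (LocallyConstant.charFn ℂ hC).isLocallyConstant
    · exact HasCompactSupport.intro hc (fun x hx => Set.indicator_of_notMem hx _)⟩

variable [IsTopologicalGroup T]

/-- The test function `h ↦ φ (h⁻¹ * x)`. -/
def Test.reflect (φ : Test T) (x : T) : Test T :=
  ⟨fun h => φ.1 (h⁻¹ * x), by
    refine ⟨φ.2.1.comp_continuous (by fun_prop), ?_⟩
    exact φ.2.2.comp_homeomorph ((Homeomorph.inv T).trans (Homeomorph.mulRight x))⟩

/-- The convolution `(Φ * φ)(x) = ∫ φ(h⁻¹ x) dΦ(h)` of a distribution with a test function. -/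
def conv (Φ : Distribution T) (φ : Test T) : T → ℂ := fun x => Φ (Test.reflect φ x)

/-- `Φ` is essentially compact: `Φ * φ` is a test function for every test function `φ`. -/
def EssentiallyCompact (Φ : Distribution T) : Prop := ∀ φ : Test T, conv Φ φ ∈ Test T

/-- The characteristic function of a coset of a compact open subgroup. -/
def Test.coset [T2Space T] (K : OpenSubgroup T) (hK : IsCompact (K : Set T))
    (c : T ⧸ (K : Subgroup T)) : Test T :=
  Test.char ((fun h : T => (h : T ⧸ (K : Subgroup T))) ⁻¹' {c})
    (by
      have : DiscreteTopology (T ⧸ (K : Subgroup T)) :=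
        QuotientGroup.discreteTopology K.isOpen
      exact (isOpen_discrete {c}).preimage QuotientGroup.continuous_mk)
    (by
      obtain ⟨g, rfl⟩ := QuotientGroup.mk_surjective c
      have h : (fun h : T => (h : T ⧸ (K : Subgroup T))) ⁻¹' {(g : T ⧸ (K : Subgroup T))}
          = (fun k => g * k) '' (K : Set T) := by
        ext x
        simp only [Set.mem_preimage, Set.mem_singleton_iff, Set.mem_image]
        constructor
        · intro hx
          exact ⟨g⁻¹ * x, QuotientGroup.eq.mp hx.symm, by simp⟩
        · rintro ⟨k, hk, rfl⟩
          exact (QuotientGroup.eq.mpr (by simpa using hk)).symm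
      rw [h]
      exact hK.image (by fun_prop))

/-- `f` is invariant under translations by the subgroup `K`. -/
def IsInvariantUnder (K : OpenSubgroup T) (f : T → ℂ) : Prop :=
  ∀ h : T, ∀ k ∈ K, f (h * k) = f h

/-- The integral `∫ f dΦ` of a smooth function `f` (invariant under some compact open subgroup, but
not necessarily of compact support) against the distribution `Φ` converges absolutely, with value
`a`: for every compact open subgroup `K` under which `f` is invariant, the series
`∑_{hK ∈ T/K} f(h) Φ(1_{hK})` converges absolutely, with sum `a`. -/
def HasIntegral [T2Space T] (Φ : Distribution T) (f : T → ℂ) (a : ℂ) : Prop :=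
  (∃ K : OpenSubgroup T, IsCompact (K : Set T) ∧ IsInvariantUnder K f) ∧
  ∀ (K : OpenSubgroup T) (hK : IsCompact (K : Set T)), IsInvariantUnder K f →
    Summable (fun c : T ⧸ (K : Subgroup T) => ‖f c.out * Φ (Test.coset K hK c)‖) ∧
    HasSum (fun c : T ⧸ (K : Subgroup T) => f c.out * Φ (Test.coset K hK c)) a

end Distributions

/-! ### `σ`-regularity -/

section Regular

variable {F : Type*} [NontriviallyNormedField F] [IsUltrametricDist F] {d : ℕ}

/-- `ϖ` generates the maximal ideal of the ring of integers of `F`. -/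
def IsUniformizer (ϖ : F) : Prop := ϖ ≠ 0 ∧ ‖ϖ‖ < 1 ∧ ∀ x : F, ‖x‖ < 1 → ‖x‖ ≤ ‖ϖ‖

/-- The subset `{x | |σ(x)| = r}` of `T`. -/
def level (sig : Fin d → ℤ) (r : ℝ) : Set (Torus F d) := {x | ‖((char F sig x : Fˣ) : F)‖ = r}

theorem isClopen_level (sig : Fin d → ℤ) (r : ℝ) : IsClopen (level (F := F) sig r) := by
  have hc : Continuous fun x : Torus F d => ((char F sig x : Fˣ) : F) := by
    refine Units.continuous_val.comp ?_
    change Continuous fun x : Torus F d => ∏ j, x j ^ sig j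
    fun_prop
  by_cases hr : r = 0
  · have h : level (F := F) sig r = (∅ : Set (Torus F d)) := by
      ext x
      simp [level, hr]
    rw [h]
    exact isClopen_empty
  · have h : level (F := F) sig r =
        (fun x : Torus F d => ((char F sig x : Fˣ) : F)) ⁻¹' Metric.sphere 0 r := by
      ext x
      simp [level]
    rw [h]
    exact (IsUltrametricDist.isClopen_sphere 0 hr).preimage hc

/-- `Φₘ = χₘ Φ`, where `χₘ` is the characteristic function of `T_m = σ⁻¹(ϖ^m 𝒪ˣ)`. -/
def piece (sig : Fin d → ℤ) (ϖ : F) (Φ : Distribution (Torus F d)) (m : ℤ) :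
    Distribution (Torus F d) :=
  Φ.comp (Test.restrict (level sig (‖ϖ‖ ^ m)) (isClopen_level sig _))

/-- `P` is a test function with `P(k x) = θ(k)⁻¹ P(x)` for all `k` in the maximal compact subgroup
`T₀ = (𝒪ˣ)^d`. Equivalently, the Mellin transform of `P` is a regular function on the variety of all
characters of `T` that is supported on the connected component of `θ`; every regular function on
that component is obtained from exactly one such `P`. -/
def InComponent (θ : Torus F d →ₜ* ℂˣ) (P : Test (Torus F d)) : Prop :=
  ∀ k x : Torus F d, (∀ j, ‖(k j : F)‖ = 1) → P.1 (k * x) = ((θ k : ℂˣ) : ℂ)⁻¹ * P.1 x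

/-- `Φ` is `σ`-regular: it is given by a rational function `f` on the variety of characters of `T`
(an element of the fraction field on every connected component) with Laurent expansion
`f(z · χ) = ∑ₘ fₘ(χ) z^m` at `z = 0`, where each coefficient `fₘ` is regular and is the one given by
the essentially compact distribution `Φₘ`. Here `z · χ = χ |σ|^s` with `z = |ϖ|^s`.

The second condition says that `∑ₘ z^m Φₘ` is a Laurent series at `z = 0`. In the third, on the
component of `θ` one has `f = Q / P`, where `P ≠ 0` and `Q = Φ * P` are test functions; as
`(Φ * P)(x)` is the finite sum of the `(Φₘ * P)(x)`, the equation `Φ * P = Q` is the comparison of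
coefficients in `(∑ₘ Φₘ z^m) (∑ₘ Pₘ z^m) = ∑ₘ Qₘ z^m`. -/
structure IsSigmaRegular (sig : Fin d → ℤ) (ϖ : F) (Φ : Distribution (Torus F d)) : Prop where
  essentiallyCompact : ∀ m : ℤ, EssentiallyCompact (piece sig ϖ Φ m)
  laurent : ∀ φ : Test (Torus F d), ∃ N : ℤ, ∀ m < N, conv (piece sig ϖ Φ m) φ = 0
  rational : ∀ θ : Torus F d →ₜ* ℂˣ, ∃ P : Test (Torus F d),
    P ≠ 0 ∧ InComponent θ P ∧ conv Φ P ∈ Test (Torus F d)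

end Regular

/-! ### The distribution `Φ_ρ` and the gamma function -/

section Gamma

variable {F : Type*} [NontriviallyNormedField F] [MeasurableSpace F] {n d : ℕ}

/-- The restriction to `Fˣ` of the additive Haar measure `μ = |dt|` of `F`. -/
def unitsMeasure (μ : Measure F) : Measure Fˣ := μ.comap Units.val

/-- The measure `|ω_ρ| = |dt₁ ⋯ dtₙ|` on `T_ρ = (Fˣ)ⁿ`. -/
def omegaMeasure (μ : Measure F) (n : ℕ) : Measure (Torus F n) :=
  Measure.pi fun _ => unitsMeasure μ

/-- `p_ρ⁻¹(C) ∩ T_ρ(r)`, where `T_ρ(r) = {t | |f_ρ(t)| ≤ r}`. -/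
def truncSet (lam : Fin n → Fin d → ℤ) (C : Set (Torus F d)) (r : ℝ) : Set (Torus F n) :=
  {t | pRho F lam t ∈ C ∧ ‖fRho t‖ ≤ r}

/-- `Φ_ρ^r(C) = ∫_{p_ρ⁻¹(C) ∩ T_ρ(r)} ψ(f_ρ(t)) |ω_ρ|`. -/
def truncIntegral (ψ : AddChar F Circle) (μ : Measure F) (lam : Fin n → Fin d → ℤ)
    (C : Set (Torus F d)) (r : ℝ) : ℂ :=
  ∫ t in truncSet lam C r, (ψ (fRho t) : ℂ) ∂omegaMeasure μ n

/-- `Φ` is the distribution with `Φ(1_C) = lim_{r → ∞} Φ_ρ^r(C)` for all compact open `C`. -/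
def IsLimitDistribution (ψ : AddChar F Circle) (μ : Measure F) (lam : Fin n → Fin d → ℤ)
    (Φ : Distribution (Torus F d)) : Prop :=
  ∀ (C : Set (Torus F d)) (ho : IsOpen C) (hc : IsCompact C),
    Filter.Tendsto (fun r : ℝ => truncIntegral ψ μ lam C r) Filter.atTop
      (nhds (Φ (Test.char C ho hc)))

/-- The rational function `R` is the gamma function of the character `χ` of `Fˣ` and of its
unramified twists: `R(|ϖ|^s) = γ_ψ(χ |·|^s)`, where `γ_ψ(χ) = ∫_{Fˣ} χ(t) ψ(t) |dt|`. The integral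
is taken as the sum over `m ∈ ℤ` of the integrals over `{|t| = |ϖ|^m}`; it converges for all small
`z = |ϖ|^s`, and this determines `R`. -/
def IsGammaFactor (ψ : AddChar F Circle) (μ : Measure F) (ϖ : F) (χ : Fˣ →* ℂˣ)
    (R : RatFunc ℂ) : Prop :=
  ∃ ε > 0, ∀ z : ℂ, 0 < ‖z‖ → ‖z‖ < ε →
    HasSum
      (fun m : ℤ => z ^ m *
        ∫ t in {t : Fˣ | ‖(t : F)‖ = ‖ϖ‖ ^ m}, ((χ t : ℂˣ) : ℂ) * (ψ (t : F) : ℂ) ∂unitsMeasure μ)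
      (R.eval (RingHom.id ℂ) z)

/-- `R(|ϖ|^s) = γ_{ρ,T}(θ |σ|^s)`, where `γ_{ρ,T}(θ) = ∏ᵢ γ_ψ(θ ∘ λᵢ)`. Note that
`(θ |σ|^s) ∘ λᵢ = (θ ∘ λᵢ) |·|^s`. -/
def IsTorusGamma (ψ : AddChar F Circle) (μ : Measure F) (ϖ : F) (lam : Fin n → Fin d → ℤ)
    (θ : Torus F d →ₜ* ℂˣ) (R : RatFunc ℂ) : Prop :=
  ∃ R' : Fin n → RatFunc ℂ,
    (∀ i, IsGammaFactor ψ μ ϖ ((θ : Torus F d →* ℂˣ).comp (cochar F (lam i))) (R' i)) ∧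
    R = ∏ i, R' i

/-- The function `θ |σ|^s` on `T`. -/
def twist (sig : Fin d → ℤ) (θ : Torus F d →ₜ* ℂˣ) (s : ℂ) (x : Torus F d) : ℂ :=
  ((θ x : ℂˣ) : ℂ) * ((‖((char F sig x : Fˣ) : F)‖ : ℝ) : ℂ) ^ s

end Gamma

end SplitTorusGamma

end

/-! Everything rests on one cancellation. A test function on T, like a character, is invariant under
the elements whose coordinates all lie in some `principalUnits F η`. Take a with ψ(a) ≠ 1 and R with
|a| ≤ R and |a| ≤ ηR. The map t ↦ t + a on {|t| > R} preserves |dt| and |t| and multiplies t by the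
principal unit 1 + a/t. Applied to one coordinate of T_ρ it leaves φ(p_ρ(t)) unchanged and
multiplies ψ(f_ρ(t)) by ψ(a). So the region where some |t_j| > R contributes nothing, and for r ≥ R
the truncated integral equals the integral over the box {|t_i| ≤ R for all i}
(`setIntegral_norm_fRho_le_eq_box`). The limit in r is eventually constant, and Φ_ρ is given by box
integrals (`IsLimitDistribution.apply_eq`).

Before truncation can be used, its domain must have finite measure (`omegaMeasure_lt_top`).
Admissibility gives σ(p_ρ(t)) = ∏ t_i, so over a compact subset of T the product of the |t_i| lies
between positive constants. The condition |f_ρ| ≤ r confines the largest coordinate to a ball of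
fixed measure once the others are given, and the others lie in a superlevel set of an integrable
weight.

For θ|σ|^s the integrand on the box factors into one-variable integrals over |t| ≤ R. For large Re s
these converge absolutely, and by the same cancellation each equals the full sum over shells.
Cutting the box along the cosets of K gives the series that defines ∫ θ|σ|^s dΦ_ρ. The shell
integrals vanish for |t| large and form a geometric progression for |t| small, so γ_ψ is rational.

For regularity, inside the box a fixed value of ∏|t_i| bounds every |t_i| from below, which makes
each Φ_m essentially compact; very negative m are impossible. For rationality on a component, P is
obtained by applying the Euler factors 1 - δλ_i(ϖ) to θ⁻¹ on the maximal compact subgroup. Moving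
the translations to the other side replaces ψ·1_{|t| ≤ R} by its difference at t and ϖ⁻¹t in each
variable (`IsLimitDistribution.conv_eulerProduct`). That difference vanishes near 0 and for |t| > R,
so Φ_ρ * P has compact support. -/

namespace SplitTorusGamma

open Filter Topology
open scoped NNReal ENNReal Pointwise

set_option linter.unusedSectionVars false

/-! ### Principal units and uniform invariance of test functions and characters -/

section Units

variable {F : Type*} [NontriviallyNormedField F] [IsUltrametricDist F]

/-- The group of `u ∈ Fˣ` with `|u| = 1` and `|u - 1| ≤ η`. -/
def principalUnits (F : Type*) [NontriviallyNormedField F] [IsUltrametricDist F] (η : ℝ≥0) :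
    Subgroup Fˣ where
  carrier := {u | ‖(u : F)‖ = 1 ∧ ‖(u : F) - 1‖ ≤ η}
  one_mem' := by simp
  mul_mem' := by
    rintro u v ⟨hu, hu'⟩ ⟨hv, hv'⟩
    refine ⟨by simp [hu, hv], ?_⟩
    have h : ((u * v : Fˣ) : F) - 1 = u * (v - 1) + (u - 1) := by push_cast; ring
    rw [h]
    refine (IsUltrametricDist.norm_add_le_max _ _).trans (max_le ?_ hu')
    rw [norm_mul, hu, one_mul]
    exact hv'
  inv_mem' := by
    rintro u ⟨hu, hu'⟩
    refine ⟨by simp [hu], ?_⟩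
    have h : ((u⁻¹ : Fˣ) : F) - 1 = (u⁻¹ : F) * (1 - u) := by
      push_cast
      field_simp
    rw [h, norm_mul, norm_inv, hu, inv_one, one_mul, norm_sub_rev]
    exact hu'

theorem principalUnits_mono {η η' : ℝ≥0} (h : η ≤ η') :
    principalUnits F η ≤ principalUnits F η' :=
  fun _ hu => ⟨hu.1, hu.2.trans (by exact_mod_cast h)⟩

theorem cochar_mem_principalUnits {d : ℕ} {η : ℝ≥0} (l : Fin d → ℤ) {u : Fˣ}
    (hu : u ∈ principalUnits F η) (j : Fin d) : cochar F l u j ∈ principalUnits F η :=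
  zpow_mem hu _

theorem norm_eq_of_norm_sub_lt {x y : F} (h : ‖x - y‖ < ‖y‖) : ‖x‖ = ‖y‖ := by
  have := IsUltrametricDist.norm_add_eq_max_of_norm_ne_norm h.ne
  rw [sub_add_cancel, max_eq_right h.le] at this
  exact this

theorem eventually_mem_principalUnits {η : ℝ≥0} (hη : 0 < η) :
    ∀ᶠ u in 𝓝 (1 : Fˣ), u ∈ principalUnits F η := by
  have hc : Tendsto (fun u : Fˣ => ‖(u : F) - 1‖) (𝓝 1) (𝓝 0) := by
    have : Continuous fun u : Fˣ => ‖(u : F) - 1‖ :=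
      (Units.continuous_val.sub continuous_const).norm
    simpa using this.tendsto 1
  filter_upwards [hc.eventually_lt_const (show (0 : ℝ) < η by exact_mod_cast hη),
    hc.eventually_lt_const one_pos] with u h1 h2
  refine ⟨?_, h1.le⟩
  simpa using norm_eq_of_norm_sub_lt (x := (u : F)) (y := 1) (by simpa using h2)

theorem eventually_forall_mem_principalUnits {d : ℕ} {η : ℝ≥0} (hη : 0 < η) :
    ∀ᶠ k in 𝓝 (1 : Torus F d), ∀ j, k j ∈ principalUnits F η := by
  rw [eventually_all]
  intro j
  exact ((continuous_apply j).tendsto (1 : Torus F d)).eventually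
    (eventually_mem_principalUnits hη)

theorem exists_principalUnits_subset_of_mem_nhds {V : Set Fˣ} (hV : V ∈ 𝓝 (1 : Fˣ)) :
    ∃ η : ℝ≥0, 0 < η ∧ ∀ u ∈ principalUnits F η, u ∈ V := by
  rw [Units.isEmbedding_val₀.nhds_eq_comap, Filter.mem_comap] at hV
  obtain ⟨W, hW, hWV⟩ := hV
  obtain ⟨ε, hε, hb⟩ := Metric.nhds_basis_closedBall.mem_iff.1 hW
  refine ⟨⟨ε, hε.le⟩, hε, fun u hu => hWV (hb ?_)⟩
  rw [Metric.mem_closedBall, dist_eq_norm]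
  exact hu.2

theorem exists_forall_principalUnits_of_mem_nhds {d : ℕ} {V : Set (Torus F d)}
    (hV : V ∈ 𝓝 (1 : Torus F d)) :
    ∃ η : ℝ≥0, 0 < η ∧ ∀ k : Torus F d, (∀ j, k j ∈ principalUnits F η) → k ∈ V := by
  rw [nhds_pi, Filter.mem_pi] at hV
  obtain ⟨I, hI, t, ht, htV⟩ := hV
  choose η hη hηt using fun j => exists_principalUnits_subset_of_mem_nhds (ht j)
  obtain ⟨ε, hε, hle⟩ : ∃ ε : ℝ≥0, 0 < ε ∧ ∀ j, ε ≤ η j := by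
    rcases isEmpty_or_nonempty (Fin d) with h | h
    · exact ⟨1, one_pos, fun j => h.elim j⟩
    · exact ⟨Finset.univ.inf' Finset.univ_nonempty η,
        (Finset.lt_inf'_iff _).2 fun j _ => hη j, fun j => Finset.inf'_le _ (Finset.mem_univ j)⟩
  exact ⟨ε, hε, fun k hk => htV fun j _ => hηt j _ (principalUnits_mono (hle j) (hk j))⟩

/-- `φ` is invariant under translation by the elements all of whose coordinates lie in
`principalUnits F η`. -/
def IsInv {d : ℕ} {α : Type*} (η : ℝ≥0) (φ : Torus F d → α) : Prop :=
  ∀ x k : Torus F d, (∀ j, k j ∈ principalUnits F η) → φ (x * k) = φ x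

variable {d : ℕ} {α : Type*} {η : ℝ≥0}

theorem IsInv.isLocallyConstant {φ : Torus F d → α} (h : IsInv η φ) (hη : 0 < η) :
    IsLocallyConstant φ := by
  rw [IsLocallyConstant.iff_eventually_eq]
  intro x
  have hc : Tendsto (fun y : Torus F d => x⁻¹ * y) (𝓝 x) (𝓝 1) := by
    have : Continuous fun y : Torus F d => x⁻¹ * y := by fun_prop
    simpa using this.tendsto x
  filter_upwards [hc.eventually (eventually_forall_mem_principalUnits hη)] with y hy
  simpa using h x (x⁻¹ * y) hy

theorem IsInv.comp_inv_mul {φ : Torus F d → α} (h : IsInv η φ) (x : Torus F d) :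
    IsInv η fun y => φ (y⁻¹ * x) := by
  intro y k hk
  have := h (y⁻¹ * x) k⁻¹ fun j => inv_mem (hk j)
  simpa [mul_inv_rev, mul_comm, mul_assoc, mul_left_comm] using this

theorem Test.exists_isInv (φ : Test (Torus F d)) : ∃ η : ℝ≥0, 0 < η ∧ IsInv η φ.1 := by
  have hlc := φ.2.1
  have hcs : IsCompact (tsupport φ.1) := φ.2.2
  -- The tube lemma around `tsupport φ.1 × {1}` inside this open set makes the invariance radius
  -- uniform over the support.
  have hopen : IsOpen {p : Torus F d × Torus F d | φ.1 (p.1 * p.2) = φ.1 p.1} := by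
    have h1 : IsLocallyConstant fun p : Torus F d × Torus F d => φ.1 (p.1 * p.2) :=
      hlc.comp_continuous (by fun_prop)
    have h2 : IsLocallyConstant fun p : Torus F d × Torus F d => φ.1 p.1 :=
      hlc.comp_continuous (by fun_prop)
    rw [isOpen_iff_mem_nhds]
    intro p hp
    filter_upwards [h1.eventually_eq p, h2.eventually_eq p] with p' e1 e2
    exact (e1.trans hp).trans e2.symm
  obtain ⟨u, v, -, hv, hu1, hv1, huv⟩ := generalized_tube_lemma hcs
    (isCompact_singleton (x := (1 : Torus F d))) hopen (by rintro ⟨x, y⟩ ⟨-, hy⟩; simp_all)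
  obtain ⟨η, hη, hk⟩ := exists_forall_principalUnits_of_mem_nhds (hv.mem_nhds (hv1 rfl))
  have key : ∀ x k : Torus F d, x ∈ tsupport φ.1 → (∀ j, k j ∈ principalUnits F η) →
      φ.1 (x * k) = φ.1 x := fun x k hx hkk => huv (Set.mk_mem_prod (hu1 hx) (hk k hkk))
  refine ⟨η, hη, fun x k hkk => ?_⟩
  by_cases hx : x ∈ tsupport φ.1
  · exact key x k hx hkk
  -- A point outside the support may be moved into it; the invariance is then used at `x * k` with
  -- `k⁻¹`.
  · by_cases hx' : x * k ∈ tsupport φ.1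
    · have := key (x * k) k⁻¹ hx' fun j => inv_mem (hkk j)
      rw [mul_inv_cancel_right] at this
      exact this.symm
    · rw [image_eq_zero_of_notMem_tsupport hx, image_eq_zero_of_notMem_tsupport hx']

theorem isInv_indicator_one {K : Subgroup (Torus F d)}
    (hK : ∀ k : Torus F d, (∀ j, k j ∈ principalUnits F η) → k ∈ K) (c : Torus F d ⧸ K) :
    IsInv η (((fun h : Torus F d => (h : Torus F d ⧸ K)) ⁻¹' {c}).indicator (1 : Torus F d → ℂ)) := by
  intro x k hk
  have : ((x * k : Torus F d) : Torus F d ⧸ K) = x :=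
    QuotientGroup.mk_mul_of_mem x (hK k hk)
  have e : (x * k ∈ (fun h : Torus F d => (h : Torus F d ⧸ K)) ⁻¹' {c}) ↔
      x ∈ (fun h : Torus F d => (h : Torus F d ⧸ K)) ⁻¹' {c} := by
    rw [Set.mem_preimage, Set.mem_preimage, this]
  by_cases hx : x ∈ (fun h : Torus F d => (h : Torus F d ⧸ K)) ⁻¹' {c}
  · rw [Set.indicator_of_mem hx, Set.indicator_of_mem (e.2 hx)]
    rfl
  · rw [Set.indicator_of_notMem hx, Set.indicator_of_notMem (mt e.1 hx)]

/-- No small subgroups in ℂˣ: as long as w = z^(2^k) stays within 1/2 of 1, |w + 1| ≥ 3/2, so each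
squaring multiplies the distance to 1 by at least 3/2. This forces characters to be trivial on small
subgroups, not merely close to 1. -/
theorem eq_one_of_norm_pow_sub_one_le {z : ℂ} (h : ∀ n : ℕ, ‖z ^ n - 1‖ ≤ 1 / 2) : z = 1 := by
  by_contra hz
  have hz' : 0 < ‖z - 1‖ := norm_pos_iff.2 (sub_ne_zero.2 hz)
  have key : ∀ k : ℕ, (3 / 2 : ℝ) ^ k * ‖z - 1‖ ≤ ‖z ^ (2 ^ k) - 1‖ := by
    intro k
    induction k with
    | zero => simp
    | succ k ih =>
      have e : z ^ (2 ^ (k + 1)) - 1 = (z ^ (2 ^ k) - 1) * (z ^ (2 ^ k) + 1) := by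
        rw [pow_succ, pow_mul]; ring
      have h3 : (3 / 2 : ℝ) ≤ ‖z ^ (2 ^ k) + 1‖ := by
        have h4 : ‖(2 : ℂ)‖ ≤ ‖z ^ (2 ^ k) + 1‖ + ‖z ^ (2 ^ k) - 1‖ := by
          have : (2 : ℂ) = (z ^ (2 ^ k) + 1) - (z ^ (2 ^ k) - 1) := by ring
          rw [this]; exact norm_sub_le _ _
        have := h (2 ^ k)
        norm_num at h4
        linarith
      rw [e, norm_mul, pow_succ]
      nlinarith [norm_nonneg (z ^ (2 ^ k) - 1)]
  obtain ⟨k, hk⟩ := pow_unbounded_of_one_lt (1 / ‖z - 1‖) (show (1 : ℝ) < 3 / 2 by norm_num)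
  have h1 := key k
  have h2 := h (2 ^ k)
  rw [div_lt_iff₀ hz'] at hk
  linarith

theorem exists_map_eq_one_of_mem_principalUnits (θ : Torus F d →ₜ* ℂˣ) :
    ∃ η : ℝ≥0, 0 < η ∧ ∀ k : Torus F d, (∀ j, k j ∈ principalUnits F η) → θ k = 1 := by
  have hV : {k : Torus F d | ‖((θ k : ℂˣ) : ℂ) - 1‖ < 1 / 2} ∈ 𝓝 (1 : Torus F d) := by
    have hc : Continuous fun k : Torus F d => ‖((θ k : ℂˣ) : ℂ) - 1‖ :=
      ((Units.continuous_val.comp θ.continuous_toFun).sub continuous_const).norm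
    refine (hc.tendsto 1).eventually_lt_const ?_
    simp
  obtain ⟨η, hη, h⟩ := exists_forall_principalUnits_of_mem_nhds hV
  refine ⟨η, hη, fun k hk => Units.ext (eq_one_of_norm_pow_sub_one_le fun n => ?_)⟩
  have : ‖((θ (k ^ n) : ℂˣ) : ℂ) - 1‖ < 1 / 2 := h (k ^ n) fun j => pow_mem (hk j) n
  simpa using le_of_lt this

end Units

/-! ### Shells |t| = |ϖ|^m of Fˣ -/

section Shells

variable {F : Type*} [NontriviallyNormedField F] [IsUltrametricDist F] {ϖ : F}

/-- The set of `t ∈ Fˣ` with `|t| = |ϖ| ^ m`. -/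
def shell (ϖ : F) (m : ℤ) : Set Fˣ := {t : Fˣ | ‖(t : F)‖ = ‖ϖ‖ ^ m}

theorem mem_shell {m : ℤ} {t : Fˣ} : t ∈ shell ϖ m ↔ ‖(t : F)‖ = ‖ϖ‖ ^ m := Iff.rfl

theorem IsUniformizer.norm_pos (hϖ : IsUniformizer ϖ) : 0 < ‖ϖ‖ := norm_pos_iff.2 hϖ.1

/-- The uniformizer as a unit. -/
def IsUniformizer.unit (hϖ : IsUniformizer ϖ) : Fˣ := Units.mk0 ϖ hϖ.1

theorem IsUniformizer.val_unit (hϖ : IsUniformizer ϖ) : (hϖ.unit : F) = ϖ := rfl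

theorem IsUniformizer.exists_mem_shell (hϖ : IsUniformizer ϖ) (t : Fˣ) :
    ∃ m : ℤ, t ∈ shell ϖ m := by
  have h0 := hϖ.norm_pos
  obtain ⟨m, hm1, hm2⟩ := exists_mem_Ico_zpow (norm_pos_iff.2 t.ne_zero)
    ((one_lt_inv₀ h0).2 hϖ.2.1)
  refine ⟨-m, ?_⟩
  rw [inv_zpow'] at hm1
  rw [inv_zpow', neg_add, zpow_add₀ h0.ne', zpow_neg_one] at hm2
  have hpos : 0 < ‖ϖ‖ ^ (-m) := zpow_pos h0 _
  by_contra hne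
  -- If the inequality were strict, ϖ^(-m)/t would have norm strictly between |ϖ| and 1,
  -- contradicting the choice of ϖ.
  have hlt : ‖ϖ‖ ^ (-m) < ‖(t : F)‖ := lt_of_le_of_ne hm1 (Ne.symm hne)
  have h1 : ‖ϖ ^ (-m) / (t : F)‖ < 1 := by
    rw [norm_div, norm_zpow, div_lt_one (norm_pos_iff.2 t.ne_zero)]
    exact hlt
  have h2 := hϖ.2.2 _ h1
  rw [norm_div, norm_zpow, div_le_iff₀ (norm_pos_iff.2 t.ne_zero)] at h2
  rw [← div_eq_mul_inv, lt_div_iff₀ h0] at hm2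
  linarith

theorem IsUniformizer.zpow_injective (hϖ : IsUniformizer ϖ) :
    Function.Injective fun m : ℤ => ‖ϖ‖ ^ m :=
  zpow_right_injective₀ hϖ.norm_pos hϖ.2.1.ne

theorem IsUniformizer.pairwise_disjoint_shell (hϖ : IsUniformizer ϖ) :
    Pairwise (Function.onFun Disjoint (shell ϖ)) := fun i j hij => by
  rw [Function.onFun, Set.disjoint_left]
  intro t hi hj
  exact hij (hϖ.zpow_injective (hi.symm.trans hj))

theorem IsUniformizer.iUnion_shell (hϖ : IsUniformizer ϖ) : ⋃ m, shell ϖ m = Set.univ :=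
  Set.eq_univ_of_forall fun t => Set.mem_iUnion.2 (hϖ.exists_mem_shell t)

end Shells

/-! ### Topology of Fˣ -/

section Topology

variable {F : Type*} [NontriviallyNormedField F]

theorem isOpenEmbedding_val : IsOpenEmbedding (Units.val : Fˣ → F) :=
  IsOpenUnits.isOpenEmbedding_unitsVal

instance secondCountableTopology_units [SecondCountableTopology F] :
    SecondCountableTopology Fˣ :=
  Units.isEmbedding_val₀.secondCountableTopology

instance borelSpace_units [MeasurableSpace F] [BorelSpace F] : BorelSpace Fˣ where
  measurable_eq := by
    rw [Units.instMeasurableSpace, BorelSpace.measurable_eq (α := F), ← borel_comap,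
      ← Units.isEmbedding_val₀.eq_induced]

theorem isCompact_norm_mem_Icc [ProperSpace F] {a b : ℝ} (ha : 0 < a) :
    IsCompact {t : Fˣ | a ≤ ‖(t : F)‖ ∧ ‖(t : F)‖ ≤ b} := by
  rw [Units.isEmbedding_val₀.isCompact_iff]
  have h : (Units.val '' {t : Fˣ | a ≤ ‖(t : F)‖ ∧ ‖(t : F)‖ ≤ b} : Set F)
      = Metric.closedBall 0 b ∩ {x | a ≤ ‖x‖} := by
    ext x
    constructor
    · rintro ⟨t, ⟨h1, h2⟩, rfl⟩
      exact ⟨by simpa using h2, h1⟩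
    · rintro ⟨h1, h2⟩
      have hx : x ≠ 0 := norm_pos_iff.1 (ha.trans_le h2)
      exact ⟨Units.mk0 x hx, ⟨h2, by simpa using h1⟩, rfl⟩
  rw [h]
  exact (isCompact_closedBall _ _).inter_right (isClosed_le continuous_const continuous_norm)

theorem continuous_norm_val : Continuous fun t : Fˣ => ‖(t : F)‖ :=
  Units.continuous_val.norm

end Topology

/-! ### Additive Haar measure restricted to Fˣ and its scaling -/

section Measure

variable {F : Type*} [NontriviallyNormedField F] [MeasurableSpace F] [BorelSpace F]

theorem measurable_norm_val : Measurable fun t : Fˣ => ‖(t : F)‖ :=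
  continuous_norm_val.measurable

theorem measurableSet_shell (ϖ : F) (m : ℤ) : MeasurableSet (shell ϖ m) :=
  measurable_norm_val (measurableSet_singleton _)

theorem measurableEmbedding_val : MeasurableEmbedding (Units.val : Fˣ → F) :=
  isOpenEmbedding_val.measurableEmbedding

theorem unitsMeasure_apply (μ : Measure F) (s : Set Fˣ) :
    unitsMeasure μ s = μ (Units.val '' s) :=
  measurableEmbedding_val.comap_apply μ s

variable [ProperSpace F] (μ : Measure F) [μ.IsAddHaarMeasure]

instance isFiniteMeasureOnCompacts_unitsMeasure : IsFiniteMeasureOnCompacts (unitsMeasure μ) :=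
  IsFiniteMeasureOnCompacts.comap' μ Units.continuous_val measurableEmbedding_val

theorem measurePreserving_mul_left (u : Fˣ) :
    MeasurePreserving (fun t => u * t) (unitsMeasure μ)
      ((distribHaarChar F u)⁻¹ • unitsMeasure μ) := by
  have hm : Measurable fun t : Fˣ => u * t :=
    (continuous_const.mul continuous_id).measurable
  refine ⟨hm, Measure.ext fun s hs => ?_⟩
  have h : Units.val '' ((fun t => u * t) ⁻¹' s) = u⁻¹ • (Units.val '' s : Set F) := by
    ext x
    rw [Set.mem_inv_smul_set_iff]
    constructor
    · rintro ⟨t, ht, rfl⟩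
      exact ⟨u * t, ht, by simp [Units.smul_def]⟩
    · rintro ⟨t, ht, he⟩
      refine ⟨u⁻¹ * t, by simpa using ht, ?_⟩
      rw [Units.smul_def, smul_eq_mul] at he
      rw [Units.val_mul, he, Units.inv_mul_cancel_left]
  rw [Measure.map_apply hm hs, unitsMeasure_apply, h, ← distribHaarChar_mul μ, map_inv,
    Measure.smul_apply, unitsMeasure_apply]
  rfl

theorem unitsMeasure_preimage_mul_left (u : Fˣ) {s : Set Fˣ} (hs : MeasurableSet s) :
    unitsMeasure μ ((fun t => u * t) ⁻¹' s)
      = ((distribHaarChar F u)⁻¹ : ℝ≥0) * unitsMeasure μ s := by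
  rw [(measurePreserving_mul_left μ u).measure_preimage hs.nullMeasurableSet, Measure.smul_apply]
  rfl

theorem integral_mul_left_unitsMeasure (u : Fˣ) (g : Fˣ → ℂ) :
    ∫ t, g (u * t) ∂unitsMeasure μ = (distribHaarChar F u : ℂ)⁻¹ * ∫ t, g t ∂unitsMeasure μ := by
  have he : MeasurableEmbedding fun t : Fˣ => u * t :=
    (Homeomorph.mulLeft u).measurableEmbedding
  rw [(measurePreserving_mul_left μ u).integral_comp he, integral_smul_nnreal_measure]
  simp [NNReal.smul_def]

end Measure

/-! ### The modulus δ of ϖ and the measure of shells -/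

section ShellMeasure

variable {F : Type*} [NontriviallyNormedField F] [IsUltrametricDist F] [MeasurableSpace F]
  [BorelSpace F] [ProperSpace F] (μ : Measure F) [μ.IsAddHaarMeasure] {ϖ : F}

/-- The factor by which multiplication by the uniformizer scales additive Haar measures. -/
noncomputable def IsUniformizer.modulus (hϖ : IsUniformizer ϖ) : ℝ := (distribHaarChar F hϖ.unit : ℝ≥0)

theorem IsUniformizer.modulus_pos (hϖ : IsUniformizer ϖ) : 0 < hϖ.modulus :=
  NNReal.coe_pos.2 distribHaarChar_pos

-- Multiplication by ϖ maps the closed unit ball into the open one, and the open one has strictly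
-- smaller measure because the ball of radius 1 around 1 lies in the complement. The norm of F need
-- not be the normalized one, so δ cannot be replaced by |ϖ|.
include μ in
theorem IsUniformizer.modulus_lt_one (hϖ : IsUniformizer ϖ) : hϖ.modulus < 1 := by
  have hB0 : μ (Metric.closedBall (0 : F) 1) ≠ 0 :=
    (Metric.measure_closedBall_pos _ _ one_pos).ne'
  have hBt : μ (Metric.closedBall (0 : F) 1) ≠ ∞ := (isCompact_closedBall _ _).measure_lt_top.ne
  have h1 : hϖ.unit • (Metric.closedBall 0 1 : Set F) ⊆ Metric.ball 0 1 := by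
    intro x hx
    obtain ⟨y, hy, rfl⟩ := Set.mem_smul_set.1 hx
    rw [Units.smul_def, hϖ.val_unit, mem_ball_zero_iff, smul_eq_mul, norm_mul]
    rw [mem_closedBall_zero_iff] at hy
    nlinarith [hϖ.2.1, norm_nonneg ϖ, norm_nonneg y]
  have h2 : μ (Metric.ball (0 : F) 1) < μ (Metric.closedBall (0 : F) 1) := by
    have hsub : Metric.ball (1 : F) 1 ⊆ Metric.closedBall (0 : F) 1 \ Metric.ball 0 1 := by
      intro x hx
      rw [mem_ball_iff_norm] at hx
      have := norm_eq_of_norm_sub_lt (x := x) (y := (1 : F)) (by simpa using hx)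
      simp [this]
    have hfin : μ (Metric.ball (0 : F) 1) ≠ ∞ :=
      ((measure_mono Metric.ball_subset_closedBall).trans_lt hBt.lt_top).ne
    have hd := measure_sdiff (μ := μ) (Metric.ball_subset_closedBall (x := (0 : F)) (ε := 1))
      Metric.isOpen_ball.measurableSet.nullMeasurableSet hfin
    have hpos : 0 < μ (Metric.closedBall (0 : F) 1 \ Metric.ball 0 1) :=
      (Metric.measure_ball_pos μ (1 : F) one_pos).trans_le (measure_mono hsub)
    rw [hd] at hpos
    exact tsub_pos_iff_lt.1 hpos
  have h3 := (distribHaarChar_mul μ hϖ.unit (Metric.closedBall 0 1)).le.trans (measure_mono h1)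
  have h4 := h3.trans_lt h2
  have h5 : ((distribHaarChar F hϖ.unit : ℝ≥0) : ℝ≥0∞) < 1 := by
    by_contra hcon
    rw [not_lt] at hcon
    exact absurd h4 (not_lt.2 (le_mul_of_one_le_left zero_le hcon))
  have h6 : distribHaarChar F hϖ.unit < 1 := by exact_mod_cast h5
  exact_mod_cast h6

theorem IsUniformizer.preimage_shell (hϖ : IsUniformizer ϖ) (k m : ℤ) :
    (fun t => hϖ.unit ^ k * t) ⁻¹' shell ϖ m = shell ϖ (m - k) := by
  ext t
  have hpos : 0 < ‖ϖ‖ ^ k := zpow_pos hϖ.norm_pos k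
  rw [Set.mem_preimage, mem_shell, mem_shell, Units.val_mul, norm_mul, Units.val_zpow_eq_zpow_val,
    norm_zpow, hϖ.val_unit, zpow_sub₀ hϖ.norm_pos.ne', eq_div_iff hpos.ne', mul_comm]

theorem unitsMeasure_shell (hϖ : IsUniformizer ϖ) (m : ℤ) :
    unitsMeasure μ (shell ϖ m) = ENNReal.ofReal (hϖ.modulus ^ m) * unitsMeasure μ (shell ϖ 0) := by
  have h := unitsMeasure_preimage_mul_left μ (hϖ.unit ^ (-m)) (measurableSet_shell ϖ 0)
  rw [hϖ.preimage_shell, zero_sub, neg_neg] at h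
  rw [h, map_zpow, zpow_neg, inv_inv, IsUniformizer.modulus, ← NNReal.coe_zpow,
    ENNReal.ofReal_coe_nnreal]

theorem unitsMeasure_shell_lt_top (hϖ : IsUniformizer ϖ) (m : ℤ) :
    unitsMeasure μ (shell ϖ m) < ∞ := by
  have hc : shell ϖ m = {t : Fˣ | ‖ϖ‖ ^ m ≤ ‖(t : F)‖ ∧ ‖(t : F)‖ ≤ ‖ϖ‖ ^ m} :=
    Set.ext fun t => ⟨fun h => ⟨h.symm.le, h.le⟩, fun h => le_antisymm h.2 h.1⟩
  rw [hc]
  exact (isCompact_norm_mem_Icc (zpow_pos hϖ.norm_pos m)).measure_lt_top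

/-- The shell of index m has δ^m times the measure of the unit shell, so ∑ b_m δ^m bounds the L¹
norm up to a constant. -/
theorem integrable_of_norm_le_shell {E : Type*} [NormedAddCommGroup E] (hϖ : IsUniformizer ϖ)
    {g : Fˣ → E}
    (hg : AEStronglyMeasurable g (unitsMeasure μ)) {b : ℤ → ℝ}
    (hb : ∀ m, ∀ t ∈ shell ϖ m, ‖g t‖ ≤ b m) (hs : Summable fun m => b m * hϖ.modulus ^ m) :
    Integrable g (unitsMeasure μ) := by
  refine ⟨hg, ?_⟩
  rw [HasFiniteIntegral, ← setLIntegral_univ, ← hϖ.iUnion_shell,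
    lintegral_iUnion (measurableSet_shell ϖ) hϖ.pairwise_disjoint_shell]
  have hle : ∀ m, ∫⁻ t in shell ϖ m, ‖g t‖ₑ ∂unitsMeasure μ
      ≤ ENNReal.ofReal (b m * hϖ.modulus ^ m) * unitsMeasure μ (shell ϖ 0) := by
    intro m
    calc ∫⁻ t in shell ϖ m, ‖g t‖ₑ ∂unitsMeasure μ
        ≤ ∫⁻ _ in shell ϖ m, ENNReal.ofReal (b m) ∂unitsMeasure μ := by
          refine setLIntegral_mono' (measurableSet_shell ϖ m) fun t ht => ?_
          rw [← ofReal_norm]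
          exact ENNReal.ofReal_le_ofReal (hb m t ht)
      _ = ENNReal.ofReal (b m * hϖ.modulus ^ m) * unitsMeasure μ (shell ϖ 0) := by
          rw [setLIntegral_const, unitsMeasure_shell μ hϖ m, ← mul_assoc,
            ENNReal.ofReal_mul' (zpow_pos hϖ.modulus_pos m).le]
  refine (ENNReal.tsum_le_tsum hle).trans_lt ?_
  rw [ENNReal.tsum_mul_right]
  exact ENNReal.mul_lt_top hs.tsum_ofReal_ne_top.lt_top (unitsMeasure_shell_lt_top μ hϖ 0)

end ShellMeasure

/-! ### The additive shift on {|t| > R} -/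

section Shift

variable {F : Type*} [NontriviallyNormedField F] [IsUltrametricDist F]

open Classical in
/-- Addition of `a` on the set `{t | R < |t|}`, and the identity elsewhere. -/
noncomputable def shift (R : ℝ) (a : F) (t : Fˣ) : Fˣ :=
  if h : R < ‖(t : F)‖ ∧ (t : F) + a ≠ 0 then Units.mk0 (t + a) h.2 else t

variable {R : ℝ} {a : F}

theorem norm_add_eq_of_lt (ha : ‖a‖ ≤ R) {x : F} (hx : R < ‖x‖) : ‖x + a‖ = ‖x‖ :=
  norm_eq_of_norm_sub_lt (by simpa using ha.trans_lt hx)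

theorem shift_of_lt (ha : ‖a‖ ≤ R) {t : Fˣ} (ht : R < ‖(t : F)‖) :
    (shift R a t : F) = t + a := by
  have h : (t : F) + a ≠ 0 := by
    rw [← norm_pos_iff, norm_add_eq_of_lt ha ht]
    exact norm_pos_iff.2 t.ne_zero
  rw [shift, dif_pos ⟨ht, h⟩]
  rfl

theorem shift_of_le {t : Fˣ} (ht : ‖(t : F)‖ ≤ R) : shift R a t = t := by
  rw [shift, dif_neg]
  exact fun h => absurd h.1 (not_lt.2 ht)

theorem norm_shift (ha : ‖a‖ ≤ R) (t : Fˣ) : ‖(shift R a t : F)‖ = ‖(t : F)‖ := by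
  rcases lt_or_ge R ‖(t : F)‖ with h | h
  · rw [shift_of_lt ha h, norm_add_eq_of_lt ha h]
  · rw [shift_of_le h]

/-- For |t| > R one has t + a = t(1 + a/t) with |a/t| ≤ |a|/R ≤ η. Thus the additive move is
invisible to functions invariant under `principalUnits F η`. -/
theorem exists_shift_eq_mul {η : ℝ≥0} (ha : ‖a‖ ≤ R) (hη : ‖a‖ ≤ η * R) (t : Fˣ) :
    ∃ u ∈ principalUnits F η, shift R a t = t * u := by
  refine ⟨t⁻¹ * shift R a t, ⟨?_, ?_⟩, by simp⟩
  · rw [Units.val_mul, norm_mul, norm_shift ha, ← norm_mul, Units.inv_mul, norm_one]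
  · rcases lt_or_ge R ‖(t : F)‖ with h | h
    · have h0 : 0 < ‖(t : F)‖ := norm_pos_iff.2 t.ne_zero
      rw [Units.val_mul, shift_of_lt ha h, mul_add, Units.inv_mul, add_sub_cancel_left, norm_mul,
        Units.val_inv_eq_inv_val, norm_inv, inv_mul_le_iff₀ h0, mul_comm]
      exact hη.trans (mul_le_mul_of_nonneg_left h.le η.2)
    · rw [shift_of_le h]
      simp

theorem shift_shift_neg (ha : ‖a‖ ≤ R) (t : Fˣ) : shift R a (shift R (-a) t) = t := by
  have ha' : ‖-a‖ ≤ R := by rwa [norm_neg]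
  rcases lt_or_ge R ‖(t : F)‖ with h | h
  · apply Units.ext
    rw [shift_of_lt ha (by rwa [norm_shift ha']), shift_of_lt ha' h]
    ring
  · rw [shift_of_le (R := R) (a := -a) h, shift_of_le h]

variable [MeasurableSpace F] [BorelSpace F] [ProperSpace F] (μ : Measure F) [μ.IsAddHaarMeasure]

theorem measurable_shift (ha : ‖a‖ ≤ R) : Measurable (shift R a) := by
  rw [← measurableEmbedding_val.measurable_comp_iff]
  have h : Units.val ∘ shift R a
      = fun t : Fˣ => if R < ‖(t : F)‖ then (t : F) + a else t := by
    funext t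
    simp only [Function.comp_apply]
    split_ifs with h
    · exact shift_of_lt ha h
    · rw [shift_of_le (not_lt.1 h)]
  rw [h]
  exact Measurable.ite (measurable_norm_val measurableSet_Ioi)
    (measurableEmbedding_val.measurable.add_const a) measurableEmbedding_val.measurable

/-- On {|t| > R}, which is stable under translation by ±a, the map is a translation of F; on the
complement it is the identity. The two parts are compared separately. -/
theorem measurePreserving_shift (ha : ‖a‖ ≤ R) :
    MeasurePreserving (shift R a) (unitsMeasure μ) (unitsMeasure μ) := by
  refine ⟨measurable_shift ha, Measure.ext fun s hs => ?_⟩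
  have hB : MeasurableSet {t : Fˣ | R < ‖(t : F)‖} := measurable_norm_val measurableSet_Ioi
  rw [Measure.map_apply (measurable_shift ha) hs,
    ← measure_inter_add_sdiff (shift R a ⁻¹' s) hB, ← measure_inter_add_sdiff s hB]
  congr 1
  · have h : Units.val '' (shift R a ⁻¹' s ∩ {t : Fˣ | R < ‖(t : F)‖})
        = (fun x => x + a) ⁻¹' (Units.val '' (s ∩ {t : Fˣ | R < ‖(t : F)‖})) := by
      ext x
      constructor
      · rintro ⟨t, ⟨h1, h2⟩, rfl⟩
        exact ⟨shift R a t, ⟨h1, by rw [Set.mem_ofPred_eq, norm_shift ha]; exact h2⟩,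
          shift_of_lt ha h2⟩
      · rintro ⟨t, ⟨h1, h2⟩, he⟩
        have ha' : ‖-a‖ ≤ R := by rwa [norm_neg]
        refine ⟨shift R (-a) t, ⟨?_, ?_⟩, ?_⟩
        · rw [Set.mem_preimage, shift_shift_neg ha]
          exact h1
        · rw [Set.mem_ofPred_eq, norm_shift ha']
          exact h2
        · rw [shift_of_lt ha' h2, he]
          ring
    rw [unitsMeasure_apply, unitsMeasure_apply, h, measure_preimage_add_right]
  · congr 1
    ext t
    refine and_congr_left fun ht => ?_
    rw [Set.mem_preimage, shift_of_le (not_lt.1 ht)]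

end Shift

/-! ### Consequences of admissibility -/

section Admissible

variable {n d : ℕ} {lam : Fin n → Fin d → ℤ} {sig : Fin d → ℤ}

theorem char_cochar {A : Type*} [Field A] (l m : Fin d → ℤ) (x : Aˣ) :
    char A m (cochar A l x) = x ^ ∑ j, l j * m j := by
  change ∏ j, (x ^ l j) ^ m j = _
  simp_rw [← zpow_mul]
  exact (map_sum (zpowersHom Aˣ x).toAdditiveRight _ Finset.univ).symm

theorem IsAdmissible.sum_mul_eq_one (h : IsAdmissible lam sig) (i : Fin n) :
    ∑ j, lam i j * sig j = 1 := by
  have h2 : (2 : ℂ) ≠ 0 := two_ne_zero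
  -- Evaluating ρ ∘ σ at z = 2 suffices: the norms give 2^⟨λᵢ, σ⟩ = 2.
  have h1 := congrFun (congrFun (h.rep_sig (Units.mk0 2 h2)) i) i
  rw [rep_apply, Matrix.diagonal_apply_eq, char_cochar] at h1
  simp only [Units.val_zpow_eq_zpow_val, Units.val_mk0, Matrix.smul_apply, Matrix.one_apply_eq,
    smul_eq_mul, mul_one] at h1
  have h3 : (2 : ℝ) ^ (∑ j, sig j * lam i j) = (2 : ℝ) ^ (1 : ℤ) := by
    rw [zpow_one]
    have := congrArg norm h1
    rwa [norm_zpow, Complex.norm_ofNat] at this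
  rw [← zpow_right_injective₀ two_pos (by norm_num) h3]
  exact Finset.sum_congr rfl fun j _ => mul_comm _ _

theorem IsAdmissible.char_cochar_eq (h : IsAdmissible lam sig) {A : Type*} [Field A] (i : Fin n)
    (x : Aˣ) : char A sig (cochar A (lam i) x) = x := by
  rw [char_cochar, h.sum_mul_eq_one, zpow_one]

theorem pRho_eq_prod {A : Type*} [Field A] (t : Torus A n) :
    pRho A lam t = ∏ i, cochar A (lam i) (t i) := rfl

theorem IsAdmissible.char_pRho (h : IsAdmissible lam sig) {A : Type*} [Field A] (t : Torus A n) :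
    char A sig (pRho A lam t) = ∏ i, t i := by
  rw [pRho_eq_prod, map_prod]
  exact Finset.prod_congr rfl fun i _ => h.char_cochar_eq i (t i)

theorem IsAdmissible.norm_char_pRho (h : IsAdmissible lam sig) {A : Type*} [NormedField A]
    (t : Torus A n) :
    ‖((char A sig (pRho A lam t) : Aˣ) : A)‖ = ∏ i, ‖(t i : A)‖ := by
  rw [h.char_pRho, Units.coe_prod, norm_prod]

end Admissible

/-! ### Continuity of p_ρ, f_ρ and |σ| -/

section Continuity

variable {F : Type*} [NontriviallyNormedField F] {n d : ℕ}

theorem continuous_cochar (l : Fin d → ℤ) : Continuous (cochar F l) := by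
  change Continuous fun x : Fˣ => fun j => x ^ l j
  fun_prop

theorem continuous_pRho (lam : Fin n → Fin d → ℤ) : Continuous (pRho F lam) := by
  change Continuous fun t : Torus F n => ∏ i, cochar F (lam i) (t i)
  exact continuous_finsetProd _ fun i _ => (continuous_cochar _).comp (continuous_apply i)

theorem continuous_fRho : Continuous (fRho : Torus F n → F) := by
  change Continuous fun t : Torus F n => ∑ i, (t i : F)
  exact continuous_finsetSum _ fun i _ => Units.continuous_val.comp (continuous_apply i)

theorem continuous_norm_char (sig : Fin d → ℤ) :
    Continuous fun x : Torus F d => ‖((char F sig x : Fˣ) : F)‖ := by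
  refine (Units.continuous_val.comp ?_).norm
  change Continuous fun x : Torus F d => ∏ j, x j ^ sig j
  fun_prop

theorem exists_norm_char_mem_Icc (sig : Fin d → ℤ) {C : Set (Torus F d)} (hC : IsCompact C) :
    ∃ a b : ℝ, 0 < a ∧ ∀ x ∈ C, ‖((char F sig x : Fˣ) : F)‖ ∈ Set.Icc a b := by
  rcases C.eq_empty_or_nonempty with rfl | hne
  · exact ⟨1, 1, one_pos, by simp⟩
  · obtain ⟨x, -, hx⟩ := hC.exists_isMinOn hne (continuous_norm_char sig).continuousOn
    obtain ⟨y, -, hy⟩ := hC.exists_isMaxOn hne (continuous_norm_char sig).continuousOn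
    exact ⟨_, _, norm_pos_iff.2 (char F sig x).ne_zero, fun z hz => ⟨hx hz, hy hz⟩⟩

end Continuity

/-! ### An inequality on valuations -/

section Combinatorics

theorem summable_pow_natAbs {ρ : ℝ} (h0 : 0 ≤ ρ) (h1 : ρ < 1) :
    Summable fun m : ℤ => ρ ^ m.natAbs := by
  rw [summable_int_iff_summable_nat_and_neg]
  simp [summable_geometric_of_lt_one h0 h1]

/-- Here x is the valuation of a largest coordinate and y lists the others. With k = N - x ≥ 0, the
hypotheses give ∑ yᵢ ≥ k - 2N and |yᵢ| ≤ N + nk. The first makes δ^(-∑ yᵢ) at least δ^(2N - k); the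
second costs at most ρ^(nN + (n² + 1)k) = ρ^(nN) δ^k. The powers of k cancel, leaving a bound
independent of x and y. -/
theorem le_prod_zpow_mul_pow {n : ℕ} {δ ρ : ℝ} (hδ0 : 0 < δ) (hδ1 : δ < 1) (hρ0 : 0 < ρ)
    (hρ1 : ρ < 1) (hρ : ρ ^ (n * n + 1) = δ) {N : ℕ} {x : ℤ} {y : Fin n → ℤ}
    (hN : |x + ∑ i, y i| ≤ N) (hx : ∀ i, x ≤ y i) :
    ρ ^ (n * N) * δ ^ (2 * N) ≤ ∏ i, (δ ^ (-y i) * ρ ^ (y i).natAbs) := by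
  obtain ⟨hN1, hN2⟩ := abs_le.1 hN
  have hsum : (n : ℤ) * x ≤ ∑ i, y i := by
    simpa using Finset.card_nsmul_le_sum Finset.univ y x fun i _ => hx i
  have hk : 0 ≤ N - x := by
    by_contra hcon
    nlinarith
  obtain ⟨k, hk'⟩ := Int.eq_ofNat_of_zero_le hk
  have habs : ∀ i, (y i).natAbs ≤ N + n * k := by
    intro i
    have hn : 1 ≤ n := Nat.one_le_iff_ne_zero.2 fun h => by subst h; exact i.elim0
    have hi : y i + ((n : ℤ) - 1) * x ≤ ∑ i, y i := by
      rw [← Finset.add_sum_erase _ y (Finset.mem_univ i)]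
      have := Finset.card_nsmul_le_sum (Finset.univ.erase i) y x fun i _ => hx i
      rw [Finset.card_erase_of_mem (Finset.mem_univ i), Finset.card_univ, Fintype.card_fin,
        nsmul_eq_mul, Nat.cast_sub hn, Nat.cast_one] at this
      linarith
    have h1 : y i ≤ N + n * k := by
      have : (n : ℤ) * k = n * N - n * x := by rw [← hk']; ring
      have : (0 : ℤ) ≤ n * N := by positivity
      linarith
    have h2 : -y i ≤ N + n * k := by
      have h3 : (k : ℤ) ≤ n * k := le_mul_of_one_le_left (by positivity) (by exact_mod_cast hn)
      have := hx i
      omega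
    zify
    exact abs_le.2 ⟨by linarith, h1⟩
  have hs : ∑ i, (y i).natAbs ≤ n * N + (n * n + 1) * k := by
    calc ∑ i, (y i).natAbs ≤ ∑ _i : Fin n, (N + n * k) := Finset.sum_le_sum fun i _ => habs i
      _ = n * (N + n * k) := by simp
      _ ≤ n * N + (n * n + 1) * k := by nlinarith
  have e1 : ∏ i, δ ^ (-y i) = δ ^ (-∑ i, y i) := by
    have : ∀ s : Finset (Fin n), ∏ i ∈ s, δ ^ (-y i) = δ ^ (-∑ i ∈ s, y i) := by
      intro s
      induction s using Finset.induction_on with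
      | empty => simp
      | insert a s ha ih =>
        rw [Finset.prod_insert ha, Finset.sum_insert ha, neg_add, zpow_add₀ hδ0.ne', ih]
    exact this _
  rw [Finset.prod_mul_distrib, e1, Finset.prod_pow_eq_pow_sum]
  have h1 : δ ^ ((2 * N : ℤ) - k) ≤ δ ^ (-∑ i, y i) :=
    zpow_le_zpow_right_of_le_one₀ hδ0 hδ1.le (by linarith)
  have h2 : ρ ^ (n * N) * δ ^ k ≤ ρ ^ ∑ i, (y i).natAbs := by
    rw [← hρ, ← pow_mul, ← pow_add]
    exact pow_le_pow_of_le_one hρ0.le hρ1.le hs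
  calc ρ ^ (n * N) * δ ^ (2 * N) = δ ^ ((2 * N : ℤ) - k) * (ρ ^ (n * N) * δ ^ k) := by
        rw [zpow_sub₀ hδ0.ne', zpow_natCast]
        have : δ ^ (2 * N : ℤ) = δ ^ (2 * N) := by exact_mod_cast zpow_natCast δ (2 * N)
        rw [this]
        field_simp
    _ ≤ _ := mul_le_mul h1 h2 (by positivity) (by positivity)

end Combinatorics

/-! ### Finite measure of the truncated domains -/

section Finiteness

variable {F : Type*} [NontriviallyNormedField F] [IsUltrametricDist F] [MeasurableSpace F]
  [BorelSpace F] [ProperSpace F] (μ : Measure F) [μ.IsAddHaarMeasure] {ϖ : F} {n : ℕ}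

/-- The integer `m` with `|t| = |ϖ| ^ m`. -/
noncomputable def IsUniformizer.ord (hϖ : IsUniformizer ϖ) (t : Fˣ) : ℤ :=
  (hϖ.exists_mem_shell t).choose

theorem IsUniformizer.norm_eq_zpow_ord (hϖ : IsUniformizer ϖ) (t : Fˣ) :
    ‖(t : F)‖ = ‖ϖ‖ ^ hϖ.ord t := (hϖ.exists_mem_shell t).choose_spec

theorem IsUniformizer.ord_eq_iff (hϖ : IsUniformizer ϖ) {t : Fˣ} {m : ℤ} :
    hϖ.ord t = m ↔ t ∈ shell ϖ m := by
  rw [mem_shell, hϖ.norm_eq_zpow_ord]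
  exact hϖ.zpow_injective.eq_iff.symm

theorem IsUniformizer.measurable_ord (hϖ : IsUniformizer ϖ) : Measurable hϖ.ord :=
  measurable_to_countable' fun m => by
    have : hϖ.ord ⁻¹' {m} = shell ϖ m := Set.ext fun t => hϖ.ord_eq_iff
    rw [this]
    exact measurableSet_shell ϖ m

theorem IsUniformizer.prod_norm (hϖ : IsUniformizer ϖ) (t : Torus F n) :
    ∏ i, ‖(t i : F)‖ = ‖ϖ‖ ^ ∑ i, hϖ.ord (t i) := by
  have : ∀ s : Finset (Fin n), ∏ i ∈ s, ‖(t i : F)‖ = ‖ϖ‖ ^ ∑ i ∈ s, hϖ.ord (t i) := by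
    intro s
    induction s using Finset.induction_on with
    | empty => simp
    | insert a s ha ih =>
      rw [Finset.prod_insert ha, Finset.sum_insert ha, zpow_add₀ hϖ.norm_pos.ne', ih,
        hϖ.norm_eq_zpow_ord]
  exact this _

theorem IsUniformizer.exists_abs_le (hϖ : IsUniformizer ϖ) {a : ℝ} (ha : 0 < a) (b : ℝ) :
    ∃ N : ℕ, ∀ m : ℤ, ‖ϖ‖ ^ m ∈ Set.Icc a b → |m| ≤ N := by
  have h0 := hϖ.norm_pos
  obtain ⟨N₁, h1⟩ := exists_pow_lt_of_lt_one ha hϖ.2.1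
  obtain ⟨N₂, h2⟩ := pow_unbounded_of_one_lt b ((one_lt_inv₀ h0).2 hϖ.2.1)
  refine ⟨max N₁ N₂, fun m hm => abs_le.2 ⟨?_, ?_⟩⟩
  · have h3 : ‖ϖ‖ ^ m < ‖ϖ‖ ^ (-(N₂ : ℤ)) := by
      rw [zpow_neg, zpow_natCast, ← inv_pow]
      exact hm.2.trans_lt h2
    have := (zpow_lt_zpow_iff_right_of_lt_one₀ h0 hϖ.2.1).1 h3
    push_cast
    have := le_max_right (N₁ : ℤ) N₂
    omega
  · have h3 : ‖ϖ‖ ^ (N₁ : ℤ) < ‖ϖ‖ ^ m := by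
      rw [zpow_natCast]
      exact h1.trans_le hm.1
    have := (zpow_lt_zpow_iff_right_of_lt_one₀ h0 hϖ.2.1).1 h3
    push_cast
    have := le_max_left (N₁ : ℤ) N₂
    omega

instance sigmaFinite_omegaMeasure : SigmaFinite (omegaMeasure μ n) :=
  inferInstanceAs (SigmaFinite (Measure.pi fun _ => unitsMeasure μ))

/-- Fubini with the largest coordinate t_j integrated first: |f_ρ| ≤ r puts t_j in a translate of
the ball of radius r, and the remaining coordinates range over a set of finite measure. -/
theorem omegaMeasure_lt_top_of_max (hϖ : IsUniformizer ϖ) (j : Fin (n + 1)) {a : ℝ} (ha : 0 < a)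
    (b r : ℝ) :
    omegaMeasure μ (n + 1) {t | ∏ i, ‖(t i : F)‖ ∈ Set.Icc a b ∧ ‖fRho t‖ ≤ r ∧
      ∀ i, ‖(t i : F)‖ ≤ ‖(t j : F)‖} < ∞ := by
  obtain ⟨N, hN⟩ := hϖ.exists_abs_le ha b
  have hδ0 := hϖ.modulus_pos
  have hδ1 := hϖ.modulus_lt_one μ
  set δ := hϖ.modulus with hδ
  -- The `+ 1` keeps the exponent positive when n = 0, so that the root exists and is less than 1.
  obtain ⟨ρ, hρ0, hρ1, hρ⟩ : ∃ ρ : ℝ, 0 < ρ ∧ ρ < 1 ∧ ρ ^ (n * n + 1) = δ :=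
    ⟨δ ^ ((↑(n * n + 1) : ℝ)⁻¹), Real.rpow_pos_of_pos hδ0 _,
      Real.rpow_lt_one hδ0.le hδ1 (by positivity), Real.rpow_inv_natCast_pow hδ0.le (by simp)⟩
  -- The factor δ^(-m) cancels the measure of the shell of index m; ρ^|m| then makes the sum over
  -- shells converge.
  let w : Fˣ → ℝ := fun t => δ ^ (-hϖ.ord t) * ρ ^ (hϖ.ord t).natAbs
  have hwm : Measurable w :=
    (measurable_from_top (f := fun m : ℤ => δ ^ (-m) * ρ ^ m.natAbs)).comp hϖ.measurable_ord
  have hw0 : ∀ t, 0 < w t := fun t => mul_pos (zpow_pos hδ0 _) (pow_pos hρ0 _)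
  have hwi : Integrable w (unitsMeasure μ) := by
    refine integrable_of_norm_le_shell μ hϖ hwm.aestronglyMeasurable
      (b := fun m => δ ^ (-m) * ρ ^ m.natAbs) (fun m t ht => ?_) ?_
    · rw [Real.norm_of_nonneg (hw0 t).le]
      simp only [w, hϖ.ord_eq_iff.2 ht, le_refl]
    · refine (summable_pow_natAbs hρ0.le hρ1).congr fun m => ?_
      rw [← hδ, zpow_neg]
      field_simp
  let W : Torus F n → ℝ := fun y => ∏ i, w (y i)
  have hWi : Integrable W (omegaMeasure μ n) := Integrable.fintype_prod fun _ => hwi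
  have hWm : Measurable W := Finset.measurable_prod _ fun i _ => hwm.comp (measurable_pi_apply i)
  set c := ρ ^ (n * N) * δ ^ (2 * N) with hc
  have hc0 : 0 < c := by positivity
  let Y : Set (Torus F n) := {y | c ≤ W y}
  have hYm : MeasurableSet Y := measurableSet_le measurable_const hWm
  -- Markov's inequality for the integrable weight `W`.
  have hY : omegaMeasure μ n Y < ∞ := by
    have := hWi.measure_norm_ge_lt_top hc0
    refine (measure_mono fun y hy => ?_).trans_lt this
    exact (show c ≤ W y from hy).trans (Real.le_norm_self _)
  let Z : Set (Fˣ × Torus F n) := {p | ‖(p.1 : F) + fRho p.2‖ ≤ r ∧ p.2 ∈ Y}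
  have hZm : MeasurableSet Z := by
    refine MeasurableSet.inter ?_ (measurable_snd hYm)
    have hcont : Continuous fun p : Fˣ × Torus F n => ‖(p.1 : F) + fRho p.2‖ :=
      ((Units.continuous_val.comp continuous_fst).add (continuous_fRho.comp continuous_snd)).norm
    exact measurableSet_le hcont.measurable measurable_const
  have hmp : MeasurePreserving (MeasurableEquiv.piFinSuccAbove (fun _ => Fˣ) j)
      (omegaMeasure μ (n + 1)) ((unitsMeasure μ).prod (omegaMeasure μ n)) :=
    measurePreserving_piFinSuccAbove (fun _ => unitsMeasure μ) j
  calc _ ≤ omegaMeasure μ (n + 1) (MeasurableEquiv.piFinSuccAbove (fun _ => Fˣ) j ⁻¹' Z) := by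
        refine measure_mono fun t ht => ⟨?_, ?_⟩
        · have : fRho t = (t j : F) + fRho fun i => t (j.succAbove i) :=
            Fin.sum_univ_succAbove (fun i => (t i : F)) j
          change ‖(t j : F) + fRho fun i => t (j.succAbove i)‖ ≤ r
          rw [← this]
          exact ht.2.1
        · change c ≤ ∏ i, w (t (j.succAbove i))
          refine le_prod_zpow_mul_pow hδ0 hδ1 hρ0 hρ1 hρ (x := hϖ.ord (t j)) ?_ fun i => ?_
          · rw [← Fin.sum_univ_succAbove (fun i => hϖ.ord (t i)) j]
            refine hN _ ?_
            rw [← hϖ.prod_norm]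
            exact ht.1
          · have := ht.2.2 (j.succAbove i)
            rw [hϖ.norm_eq_zpow_ord, hϖ.norm_eq_zpow_ord (t j)] at this
            exact (zpow_le_zpow_iff_right_of_lt_one₀ hϖ.norm_pos hϖ.2.1).1 this
    _ = ((unitsMeasure μ).prod (omegaMeasure μ n)) Z :=
        hmp.measure_preimage hZm.nullMeasurableSet
    _ = ∫⁻ y, unitsMeasure μ ((fun x => (x, y)) ⁻¹' Z) ∂omegaMeasure μ n :=
        Measure.prod_apply_symm hZm
    _ ≤ ∫⁻ y, Y.indicator (fun _ => μ (Metric.closedBall 0 r)) y ∂omegaMeasure μ n := by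
        refine lintegral_mono fun y => ?_
        by_cases hy : y ∈ Y
        · rw [Set.indicator_of_mem hy, unitsMeasure_apply,
            ← measure_preimage_add_right μ (fRho y) (Metric.closedBall 0 r)]
          refine measure_mono ?_
          rintro _ ⟨x, hx, rfl⟩
          rw [Set.mem_preimage, mem_closedBall_zero_iff]
          exact hx.1
        · have : (fun x => (x, y)) ⁻¹' Z = ∅ := Set.eq_empty_of_forall_notMem fun x hx => hy hx.2
          rw [this, measure_empty]
          exact zero_le
    _ = μ (Metric.closedBall 0 r) * omegaMeasure μ n Y := by
        rw [lintegral_indicator_const hYm]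
    _ < ∞ := ENNReal.mul_lt_top (isCompact_closedBall _ _).measure_lt_top hY

theorem omegaMeasure_lt_top (hϖ : IsUniformizer ϖ) {a : ℝ} (ha : 0 < a) (b r : ℝ) :
    omegaMeasure μ n {t | ∏ i, ‖(t i : F)‖ ∈ Set.Icc a b ∧ ‖fRho t‖ ≤ r} < ∞ := by
  cases n with
  | zero =>
    refine (measure_mono (Set.subset_univ _)).trans_lt ?_
    rw [omegaMeasure, Measure.pi_univ]
    simp
  | succ n =>
    refine (measure_mono (t := ⋃ j : Fin (n + 1), {t : Torus F (n + 1) |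
      ∏ i, ‖(t i : F)‖ ∈ Set.Icc a b ∧ ‖fRho t‖ ≤ r ∧ ∀ i, ‖(t i : F)‖ ≤ ‖(t j : F)‖})
      fun t ht => ?_).trans_lt ?_
    · obtain ⟨j, hj⟩ := Finite.exists_max fun i => ‖(t i : F)‖
      exact Set.mem_iUnion.2 ⟨j, ht.1, ht.2, hj⟩
    · refine (measure_iUnion_fintype_le _ _).trans_lt ?_
      exact ENNReal.sum_lt_top.2 fun j _ => omegaMeasure_lt_top_of_max μ hϖ j ha b r

theorem omegaMeasure_truncSet_lt_top {d : ℕ} {lam : Fin n → Fin d → ℤ} {sig : Fin d → ℤ}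
    (hϖ : IsUniformizer ϖ) (hρ : IsAdmissible lam sig) {C : Set (Torus F d)} (hC : IsCompact C)
    (r : ℝ) : omegaMeasure μ n (truncSet lam C r) < ∞ := by
  obtain ⟨a, b, ha, hab⟩ := exists_norm_char_mem_Icc sig hC
  refine lt_of_le_of_lt (measure_mono ?_) (omegaMeasure_lt_top μ hϖ ha b r)
  intro t ht
  refine ⟨?_, ht.2⟩
  rw [← hρ.norm_char_pRho]
  exact hab _ ht.1

end Finiteness

/-! ### Cancellation outside the box -/

section Vanishing

/-- The integral I satisfies I = cI with c ≠ 1. Integrability of g is not needed, since the change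
of variables holds for the Bochner integral in any case. -/
theorem integral_eq_zero_of_comp_eq_mul {X : Type*} [MeasurableSpace X] {ν : Measure X}
    {e : X → X} (he : MeasurePreserving e ν ν) {g : X → ℂ} (hg : AEStronglyMeasurable g ν) {c : ℂ}
    (hc : c ≠ 1) (h : ∀ x, g (e x) = c * g x) : ∫ x, g x ∂ν = 0 := by
  have h1 : ∫ x, g (e x) ∂ν = ∫ x, g x ∂ν := by
    rw [← integral_map he.measurable.aemeasurable (by rwa [he.map_eq]), he.map_eq]
  simp_rw [h, integral_const_mul] at h1
  by_contra h0
  exact hc (mul_right_cancel₀ h0 (by rw [h1, one_mul]))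

variable {F : Type*} [NontriviallyNormedField F] [IsUltrametricDist F] {n d : ℕ}

/-- The box `{t | |tᵢ| ≤ R for all i}` in `T_ρ`. -/
def box (F : Type*) [NontriviallyNormedField F] (n : ℕ) (R : ℝ) : Set (Torus F n) :=
  {t | ∀ i, ‖(t i : F)‖ ≤ R}

theorem isClosed_box (R : ℝ) : IsClosed (box F n R) := by
  have : box F n R = ⋂ i, {t : Torus F n | ‖(t i : F)‖ ≤ R} := by
    ext t
    rw [Set.mem_iInter]
    rfl
  rw [this]
  exact isClosed_iInter fun i =>
    isClosed_le (continuous_norm_val.comp (continuous_apply i)) continuous_const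

theorem norm_fRho_le_of_mem_box {R : ℝ} (hR : 0 ≤ R) {t : Torus F n} (ht : t ∈ box F n R) :
    ‖fRho t‖ ≤ R :=
  IsUltrametricDist.norm_sum_le_of_forall_le_of_nonneg hR fun i _ => ht i

open Classical in
/-- The map `shift R a` applied to the `j`-th coordinate. -/
noncomputable def shiftAt (R : ℝ) (a : F) (j : Fin n) (t : Torus F n) : Torus F n :=
  fun i => (if i = j then shift R a else id) (t i)

variable {R : ℝ} {a : F} {j : Fin n}

theorem shiftAt_same (t : Torus F n) : shiftAt R a j t j = shift R a (t j) := by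
  rw [shiftAt, if_pos rfl]

theorem shiftAt_of_ne (t : Torus F n) {i : Fin n} (h : i ≠ j) : shiftAt R a j t i = t i := by
  rw [shiftAt, if_neg h, id]

theorem norm_shiftAt (ha : ‖a‖ ≤ R) (t : Torus F n) (i : Fin n) :
    ‖(shiftAt R a j t i : F)‖ = ‖(t i : F)‖ := by
  by_cases h : i = j
  · subst h
    rw [shiftAt_same, norm_shift ha]
  · rw [shiftAt_of_ne t h]

theorem fRho_shiftAt_of_lt (ha : ‖a‖ ≤ R) {t : Torus F n} (h : R < ‖(t j : F)‖) :
    fRho (shiftAt R a j t) = fRho t + a := by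
  rw [fRho, fRho, ← Finset.add_sum_erase _ _ (Finset.mem_univ j),
    ← Finset.add_sum_erase _ (fun i => (t i : F)) (Finset.mem_univ j), shiftAt_same,
    shift_of_lt ha h, Finset.sum_congr rfl fun i hi => by
      rw [shiftAt_of_ne t (Finset.ne_of_mem_erase hi)]]
  ring

theorem shiftAt_of_le {t : Torus F n} (h : ‖(t j : F)‖ ≤ R) : shiftAt R a j t = t := by
  funext i
  by_cases hi : i = j
  · subst hi
    rw [shiftAt_same, shift_of_le h]
  · rw [shiftAt_of_ne t hi]

theorem exists_shiftAt_eq_mul {η : ℝ≥0} (ha : ‖a‖ ≤ R) (hη : ‖a‖ ≤ η * R) (t : Torus F n) :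
    ∃ u : Torus F n, (∀ i, u i ∈ principalUnits F η) ∧ shiftAt R a j t = t * u := by
  choose u hu hut using fun t : Fˣ => exists_shift_eq_mul ha hη t
  refine ⟨fun i => if i = j then u (t i) else 1, fun i => ?_, ?_⟩
  · dsimp only
    split_ifs
    · exact hu _
    · exact one_mem _
  · funext i
    by_cases hi : i = j
    · subst hi
      rw [shiftAt_same, hut, Pi.mul_apply, if_pos rfl]
    · rw [shiftAt_of_ne t hi, Pi.mul_apply, if_neg hi, mul_one]

theorem pRho_mem_principalUnits {η : ℝ≥0} (lam : Fin n → Fin d → ℤ) {u : Torus F n}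
    (hu : ∀ i, u i ∈ principalUnits F η) (k : Fin d) :
    pRho F lam u k ∈ principalUnits F η := by
  rw [pRho_eq_prod, Finset.prod_apply]
  exact prod_mem fun i _ => cochar_mem_principalUnits _ (hu i) k

theorem norm_add_le_iff {r : ℝ} {x : F} (ha : ‖a‖ ≤ r) : ‖x + a‖ ≤ r ↔ ‖x‖ ≤ r := by
  refine ⟨fun h => ?_, fun h => (IsUltrametricDist.norm_add_le_max x a).trans (max_le h ha)⟩
  have := (IsUltrametricDist.norm_add_le_max (x + a) (-a)).trans
    (max_le h (by rwa [norm_neg]))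
  rwa [add_neg_cancel_right] at this

variable [MeasurableSpace F] [BorelSpace F] [ProperSpace F] (μ : Measure F) [μ.IsAddHaarMeasure]

theorem measurePreserving_shiftAt (ha : ‖a‖ ≤ R) :
    MeasurePreserving (shiftAt R a j) (omegaMeasure μ n) (omegaMeasure μ n) := by
  classical
  refine measurePreserving_pi (fun _ => unitsMeasure μ) (fun _ => unitsMeasure μ)
    (f := fun i => if i = j then shift R a else id) fun i => ?_
  split_ifs
  · exact measurePreserving_shift μ ha
  · exact MeasurePreserving.id _

variable {ψ : AddChar F Circle} {φ : Torus F d → ℂ} {η : ℝ≥0} {lam : Fin n → Fin d → ℤ}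

theorem continuous_pairing (hψ : Continuous ψ) (hφ : Continuous φ) :
    Continuous fun t : Torus F n => φ (pRho F lam t) * (ψ (fRho t) : ℂ) :=
  (hφ.comp (continuous_pRho lam)).mul
    (continuous_induced_dom.comp (hψ.comp continuous_fRho))

theorem setIntegral_inter_lt_eq_zero (hψ : Continuous ψ) (hφc : Continuous φ) (hφ : IsInv η φ)
    (ha : ‖a‖ ≤ R) (hη : ‖a‖ ≤ η * R) (hψa : ψ a ≠ 1) {E : Set (Torus F n)}
    (hE : MeasurableSet E) (hEa : ∀ t, shiftAt R a j t ∈ E ↔ t ∈ E) :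
    ∫ t in E ∩ {t | R < ‖(t j : F)‖}, φ (pRho F lam t) * (ψ (fRho t) : ℂ)
      ∂omegaMeasure μ n = 0 := by
  have hm : MeasurableSet (E ∩ {t : Torus F n | R < ‖(t j : F)‖}) :=
    hE.inter ((measurable_norm_val.comp (measurable_pi_apply j)) measurableSet_Ioi)
  rw [← integral_indicator hm]
  refine integral_eq_zero_of_comp_eq_mul (measurePreserving_shiftAt (j := j) μ ha)
    ((continuous_pairing hψ hφc).measurable.indicator hm).aestronglyMeasurable
    (c := ψ a) (fun h => hψa (Circle.ext h)) fun t => ?_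
  have hiff : shiftAt R a j t ∈ E ∩ {t : Torus F n | R < ‖(t j : F)‖} ↔
      t ∈ E ∩ {t : Torus F n | R < ‖(t j : F)‖} := by
    refine and_congr (hEa t) ?_
    rw [Set.mem_ofPred_eq, norm_shiftAt ha]
    rfl
  by_cases ht : t ∈ E ∩ {t : Torus F n | R < ‖(t j : F)‖}
  · rw [Set.indicator_of_mem ht, Set.indicator_of_mem (hiff.2 ht), fRho_shiftAt_of_lt ha ht.2]
    obtain ⟨u, hu, hut⟩ := exists_shiftAt_eq_mul (j := j) ha hη t
    rw [hut, map_mul, hφ _ _ (pRho_mem_principalUnits lam hu), AddChar.map_add_eq_mul,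
      Circle.coe_mul]
    ring
  · rw [Set.indicator_of_notMem ht, Set.indicator_of_notMem (mt hiff.1 ht), mul_zero]

/-- The coordinates are confined to |t_i| ≤ R one at a time: each step discards a region stable
under the shift of one coordinate. The bound R ≤ r makes the condition |f_ρ| ≤ r stable under adding
a, and also places the box inside the truncated domain. -/
theorem setIntegral_norm_fRho_le_eq_box (hψ : Continuous ψ) (hφc : Continuous φ)
    (hφ : IsInv η φ) (ha : ‖a‖ ≤ R) (hη : ‖a‖ ≤ η * R) (hψa : ψ a ≠ 1) {r : ℝ} (hr : R ≤ r)
    (hint : IntegrableOn (fun t : Torus F n => φ (pRho F lam t) * (ψ (fRho t) : ℂ))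
      {t | ‖fRho t‖ ≤ r} (omegaMeasure μ n)) :
    ∫ t in {t | ‖fRho t‖ ≤ r}, φ (pRho F lam t) * (ψ (fRho t) : ℂ) ∂omegaMeasure μ n
      = ∫ t in box F n R, φ (pRho F lam t) * (ψ (fRho t) : ℂ) ∂omegaMeasure μ n := by
  classical
  let E : Finset (Fin n) → Set (Torus F n) := fun S =>
    {t | ‖fRho t‖ ≤ r} ∩ {t | ∀ i ∈ S, ‖(t i : F)‖ ≤ R}
  have hD : MeasurableSet {t : Torus F n | ‖fRho t‖ ≤ r} :=
    (isClosed_le continuous_fRho.norm continuous_const).measurableSet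
  have hEm : ∀ S, MeasurableSet (E S) := fun S => by
    refine hD.inter ?_
    have : {t : Torus F n | ∀ i ∈ S, ‖(t i : F)‖ ≤ R}
        = ⋂ i ∈ S, (fun t : Torus F n => ‖(t i : F)‖) ⁻¹' Set.Iic R := by
      ext t
      simp only [Set.mem_iInter]
      rfl
    rw [this]
    exact Finset.measurableSet_biInter _ fun i _ =>
      (measurable_norm_val.comp (measurable_pi_apply i)) measurableSet_Iic
  have hEinv : ∀ S j t, shiftAt R a j t ∈ E S ↔ t ∈ E S := by
    intro S j t
    refine and_congr ?_ ?_
    · rcases lt_or_ge R ‖(t j : F)‖ with h | h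
      · rw [Set.mem_ofPred_eq, fRho_shiftAt_of_lt ha h, norm_add_le_iff (ha.trans hr)]
        rfl
      · rw [shiftAt_of_le h]
    · simp only [Set.mem_ofPred_eq, norm_shiftAt ha]
  have key : ∀ S, ∫ t in {t | ‖fRho t‖ ≤ r}, φ (pRho F lam t) * (ψ (fRho t) : ℂ)
        ∂omegaMeasure μ n
      = ∫ t in E S, φ (pRho F lam t) * (ψ (fRho t) : ℂ) ∂omegaMeasure μ n := by
    intro S
    induction S using Finset.induction_on with
    | empty => simp [E]
    | insert j S hj ih =>
      have hB : MeasurableSet {t : Torus F n | R < ‖(t j : F)‖} :=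
        (measurable_norm_val.comp (measurable_pi_apply j)) measurableSet_Ioi
      rw [ih, ← integral_inter_add_sdiff hB (hint.mono_set Set.inter_subset_left),
        setIntegral_inter_lt_eq_zero μ hψ hφc hφ ha hη hψa (hEm S) (hEinv S j), zero_add]
      congr 2
      ext t
      simp only [E, Set.mem_sdiff, Set.mem_inter_iff, Set.mem_ofPred_eq, not_lt,
        Finset.forall_mem_insert]
      tauto
  rw [key Finset.univ]
  congr 2
  ext t
  constructor
  · exact fun h i => h.2 i (Finset.mem_univ i)
  · exact fun h => ⟨(norm_fRho_le_of_mem_box ((norm_nonneg a).trans ha) h).trans hr, fun i _ => h i⟩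

end Vanishing

/-! ### Existence, uniqueness and box formula for Φ_ρ -/

section Limit

variable {F : Type*} [NontriviallyNormedField F] [IsUltrametricDist F] {n d : ℕ}
  [MeasurableSpace F] [BorelSpace F] [ProperSpace F] (μ : Measure F) [μ.IsAddHaarMeasure]
  {ψ : AddChar F Circle} {lam : Fin n → Fin d → ℤ} {sig : Fin d → ℤ} {ϖ : F}

theorem integrableOn_pairing (hϖ : IsUniformizer ϖ) (hρ : IsAdmissible lam sig)
    (hψ : Continuous ψ) (φ : Test (Torus F d)) (r : ℝ) :
    IntegrableOn (fun t : Torus F n => φ.1 (pRho F lam t) * (ψ (fRho t) : ℂ))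
      {t | ‖fRho t‖ ≤ r} (omegaMeasure μ n) := by
  have hc : Continuous φ.1 := φ.2.1.continuous
  obtain ⟨M, hM⟩ := φ.2.2.exists_bound_of_continuous hc
  have hfin := omegaMeasure_truncSet_lt_top μ hϖ hρ (φ.2.2 : IsCompact (tsupport φ.1)) r
  have hD : MeasurableSet {t : Torus F n | ‖fRho t‖ ≤ r} :=
    (isClosed_le continuous_fRho.norm continuous_const).measurableSet
  have h1 : IntegrableOn (fun t : Torus F n => φ.1 (pRho F lam t) * (ψ (fRho t) : ℂ))
      (truncSet lam (tsupport φ.1) r) (omegaMeasure μ n) := by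
    refine Measure.integrableOn_of_bounded (M := M) hfin.ne
      (continuous_pairing hψ hc).measurable.aestronglyMeasurable ?_
    refine Eventually.of_forall fun t => ?_
    rw [norm_mul, Circle.norm_coe, mul_one]
    exact hM _
  refine h1.of_forall_sdiff_eq_zero hD fun t ht => ?_
  have : pRho F lam t ∉ tsupport φ.1 := fun h => ht.2 ⟨h, ht.1⟩
  rw [image_eq_zero_of_notMem_tsupport this, zero_mul]

theorem truncIntegral_eq {C : Set (Torus F d)} (ho : IsOpen C) (hc : IsCompact C) (r : ℝ) :
    truncIntegral ψ μ lam C r = ∫ t in {t | ‖fRho t‖ ≤ r},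
      (Test.char C ho hc).1 (pRho F lam t) * (ψ (fRho t) : ℂ) ∂omegaMeasure μ n := by
  have hm : MeasurableSet (pRho F lam ⁻¹' C) :=
    (ho.preimage (continuous_pRho lam)).measurableSet
  have h : ∀ t : Torus F n, (Test.char C ho hc).1 (pRho F lam t) * (ψ (fRho t) : ℂ)
      = (pRho F lam ⁻¹' C).indicator (fun t => (ψ (fRho t) : ℂ)) t := by
    intro t
    change C.indicator 1 (pRho F lam t) * (ψ (fRho t) : ℂ) = _
    by_cases ht : pRho F lam t ∈ C
    · rw [Set.indicator_of_mem ht, Set.indicator_of_mem (Set.mem_preimage.2 ht), Pi.one_apply,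
        one_mul]
    · rw [Set.indicator_of_notMem ht, Set.indicator_of_notMem (mt Set.mem_preimage.1 ht), zero_mul]
  simp_rw [h]
  rw [setIntegral_indicator hm, Set.inter_comm]
  rfl

theorem Test.isLocallyConstant {T : Type*} [CommGroup T] [TopologicalSpace T] (φ : Test T) :
    IsLocallyConstant φ.1 := φ.2.1

theorem Test.hasCompactSupport {T : Type*} [CommGroup T] [TopologicalSpace T] (φ : Test T) :
    HasCompactSupport φ.1 := φ.2.2

theorem Test.eq_sum_char {T : Type*} [CommGroup T] [TopologicalSpace T] [T2Space T] (φ : Test T) :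
    ∃ (s : Finset ℂ) (ho : ∀ y ∈ s, IsOpen (φ.1 ⁻¹' {y}))
      (hc : ∀ y ∈ s, IsCompact (φ.1 ⁻¹' {y})),
      φ = ∑ y : s, (y : ℂ) • Test.char (φ.1 ⁻¹' {y.1}) (ho y y.2) (hc y y.2) := by
  have hfin : (Set.range φ.1).Finite := by
    have h1 : (φ.1 '' tsupport φ.1).Finite := by
      have hK : IsCompact (tsupport φ.1) := Test.hasCompactSupport φ
      obtain ⟨t, -, ht⟩ := hK.elim_nhds_subcover (fun x => φ.1 ⁻¹' {φ.1 x})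
        fun x _ => (Test.isLocallyConstant φ).eventually_eq x
      refine (t.finite_toSet.image φ.1).subset ?_
      rintro _ ⟨x, hx, rfl⟩
      obtain ⟨y, hy, hxy⟩ := Set.mem_iUnion₂.1 (ht hx)
      exact ⟨y, hy, hxy.symm⟩
    refine (h1.union (Set.finite_singleton 0)).subset ?_
    rintro _ ⟨x, rfl⟩
    by_cases hx : x ∈ tsupport φ.1
    · exact Or.inl ⟨x, hx, rfl⟩
    · exact Or.inr (image_eq_zero_of_notMem_tsupport hx)
  classical
  -- The value 0 is dropped: its fibre need not be compact, and it contributes nothing.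
  refine ⟨hfin.toFinset.erase 0, fun y _ => (Test.isLocallyConstant φ).isOpen_fiber y, fun y hy => ?_, ?_⟩
  · refine (Test.hasCompactSupport φ).of_isClosed_subset ((Test.isLocallyConstant φ).isClosed_fiber y) fun x hx => subset_tsupport _ ?_
    rw [Function.mem_support, show φ.1 x = y from hx]
    exact Finset.ne_of_mem_erase hy
  · apply Subtype.ext
    funext x
    rw [AddSubmonoidClass.coe_finsetSum, Finset.sum_apply]
    have hterm : ∀ y : (hfin.toFinset.erase 0 : Finset ℂ), ∀ ho hc,
        ((y : ℂ) • Test.char (φ.1 ⁻¹' {y.1}) ho hc : Test T).1 x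
          = if φ.1 x = y.1 then y.1 else 0 := by
      intro y ho hc
      change (y : ℂ) • (φ.1 ⁻¹' {y.1}).indicator (1 : T → ℂ) x = _
      by_cases h : φ.1 x = y.1
      · rw [Set.indicator_of_mem (show x ∈ φ.1 ⁻¹' {y.1} from h), if_pos h]
        simp
      · rw [Set.indicator_of_notMem (show x ∉ φ.1 ⁻¹' {y.1} from h), if_neg h, smul_zero]
    refine Eq.trans ?_ (Finset.sum_congr rfl fun y _ => (hterm y _ _).symm)
    rw [Finset.sum_coe_sort (hfin.toFinset.erase 0) fun y => if φ.1 x = y then y else 0,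
      Finset.sum_ite_eq]
    split_ifs with h
    · rfl
    · by_contra h0
      exact h (Finset.mem_erase.2 ⟨h0, hfin.mem_toFinset.2 ⟨x, rfl⟩⟩)

theorem Distribution.ext_char {T : Type*} [CommGroup T] [TopologicalSpace T] [T2Space T]
    {Φ Φ' : Distribution T}
    (h : ∀ C ho hc, Φ (Test.char C ho hc) = Φ' (Test.char C ho hc)) : Φ = Φ' := by
  refine LinearMap.ext fun φ => ?_
  obtain ⟨s, ho, hc, hφ⟩ := Test.eq_sum_char φ
  rw [hφ, map_sum, map_sum]
  refine Finset.sum_congr rfl fun y _ => ?_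
  rw [map_smul, map_smul, h]

theorem exists_radius (a : F) {η : ℝ≥0} (hη : 0 < η) :
    ∃ R₀ : ℝ, ∀ R, R₀ ≤ R → ‖a‖ ≤ R ∧ ‖a‖ ≤ η * R := by
  have hη' : (0 : ℝ) < η := by exact_mod_cast hη
  refine ⟨max ‖a‖ (‖a‖ / η), fun R hR => ⟨(le_max_left _ _).trans hR, ?_⟩⟩
  rw [mul_comm, ← div_le_iff₀ hη']
  exact (le_max_right _ _).trans hR

/-- The truncated integrals are constant from r = R on. -/
theorem tendsto_pairing (hϖ : IsUniformizer ϖ) (hρ : IsAdmissible lam sig) (hψ : Continuous ψ)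
    (φ : Test (Torus F d)) {η : ℝ≥0} (hφ : IsInv η φ.1) {a : F} {R : ℝ} (ha : ‖a‖ ≤ R)
    (hη : ‖a‖ ≤ η * R) (hψa : ψ a ≠ 1) :
    Tendsto (fun r => ∫ t in {t | ‖fRho t‖ ≤ r},
        φ.1 (pRho F lam t) * (ψ (fRho t) : ℂ) ∂omegaMeasure μ n) atTop
      (𝓝 (∫ t in box F n R, φ.1 (pRho F lam t) * (ψ (fRho t) : ℂ) ∂omegaMeasure μ n)) := by
  refine tendsto_const_nhds.congr' ?_
  filter_upwards [eventually_ge_atTop R] with r hr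
  exact (setIntegral_norm_fRho_le_eq_box μ hψ φ.2.1.continuous hφ ha hη hψa hr
    (integrableOn_pairing μ hϖ hρ hψ φ r)).symm

theorem existsUnique_isLimitDistribution (hϖ : IsUniformizer ϖ) (hρ : IsAdmissible lam sig)
    (hψ : Continuous ψ) (hψ1 : ψ ≠ 1) :
    ∃ Φ : Distribution (Torus F d), IsLimitDistribution ψ μ lam Φ ∧
      (∀ Φ', IsLimitDistribution ψ μ lam Φ' → Φ' = Φ) ∧
      ∀ (φ : Test (Torus F d)) (η : ℝ≥0) (a : F) (R : ℝ), IsInv η φ.1 → ‖a‖ ≤ R →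
        ‖a‖ ≤ η * R → ψ a ≠ 1 →
        Φ φ = ∫ t in box F n R, φ.1 (pRho F lam t) * (ψ (fRho t) : ℂ) ∂omegaMeasure μ n := by
  have hlim : ∀ φ : Test (Torus F d), ∃ z : ℂ,
      Tendsto (fun r => ∫ t in {t | ‖fRho t‖ ≤ r},
        φ.1 (pRho F lam t) * (ψ (fRho t) : ℂ) ∂omegaMeasure μ n) atTop (𝓝 z) := by
    intro φ
    obtain ⟨η, hη, hφ⟩ := Test.exists_isInv φ
    obtain ⟨a, ha⟩ := AddChar.ne_one_iff.1 hψ1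
    obtain ⟨R, hR⟩ := exists_radius a hη
    exact ⟨_, tendsto_pairing μ hϖ hρ hψ φ hφ (hR R le_rfl).1 (hR R le_rfl).2 ha⟩
  choose L hL using hlim
  let Φ : Distribution (Torus F d) :=
    { toFun := L
      map_add' := fun φ φ' => by
        refine tendsto_nhds_unique (hL _) (((hL φ).add (hL φ')).congr fun r => ?_)
        rw [← integral_add (integrableOn_pairing μ hϖ hρ hψ φ r)
          (integrableOn_pairing μ hϖ hρ hψ φ' r)]
        exact integral_congr_ae (Eventually.of_forall fun t => (add_mul _ _ _).symm)
      map_smul' := fun c φ => by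
        refine tendsto_nhds_unique (hL _) (((hL φ).const_mul c).congr fun r => ?_)
        rw [← integral_const_mul]
        exact integral_congr_ae (Eventually.of_forall fun t => (mul_assoc _ _ _).symm) }
  have hΦ : IsLimitDistribution ψ μ lam Φ := fun C ho hc =>
    (hL (Test.char C ho hc)).congr fun r => (truncIntegral_eq μ ho hc r).symm
  exact ⟨Φ, hΦ, fun Φ' h' => Distribution.ext_char fun C ho hc =>
    tendsto_nhds_unique (h' C ho hc) (hΦ C ho hc), fun φ η a R hφ ha hη hψa =>
    tendsto_nhds_unique (hL φ) (tendsto_pairing μ hϖ hρ hψ φ hφ ha hη hψa)⟩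

theorem IsLimitDistribution.apply_eq (hϖ : IsUniformizer ϖ) (hρ : IsAdmissible lam sig)
    (hψ : Continuous ψ) {Φ : Distribution (Torus F d)} (hΦ : IsLimitDistribution ψ μ lam Φ)
    (φ : Test (Torus F d)) {η : ℝ≥0} {a : F} {R : ℝ} (hφ : IsInv η φ.1) (ha : ‖a‖ ≤ R)
    (hη : ‖a‖ ≤ η * R) (hψa : ψ a ≠ 1) :
    Φ φ = ∫ t in box F n R, φ.1 (pRho F lam t) * (ψ (fRho t) : ℂ) ∂omegaMeasure μ n := by
  obtain ⟨Φ', -, huniq, hval⟩ := existsUnique_isLimitDistribution μ hϖ hρ hψ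
    (AddChar.ne_one_iff.2 ⟨a, hψa⟩)
  rw [huniq Φ hΦ, hval φ η a R hφ ha hη hψa]

end Limit

/-! ### Rational functions and eventually geometric Laurent series -/

section RationalFunctions

-- `RatFunc.eval` uses the reduced fraction, whose denominator divides q and hence is also non-zero
-- at z.
open Polynomial in
theorem eval_ratFunc_div {p q : ℂ[X]} {z : ℂ} (hq : q.eval z ≠ 0) :
    (algebraMap ℂ[X] (RatFunc ℂ) p / algebraMap ℂ[X] (RatFunc ℂ) q).eval (RingHom.id ℂ) z
      = p.eval z / q.eval z := by
  have hq0 : q ≠ 0 := by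
    rintro rfl
    simp at hq
  set x := algebraMap ℂ[X] (RatFunc ℂ) p / algebraMap ℂ[X] (RatFunc ℂ) q with hx
  have h1 := congrArg (Polynomial.eval z) ((RatFunc.num_mul_eq_mul_denom_iff hq0).2 hx)
  obtain ⟨c, hc⟩ := RatFunc.denom_div_dvd p q
  have h2 : (RatFunc.denom x).eval z ≠ 0 := by
    intro h
    rw [hc, eval_mul, ← hx, h, zero_mul] at hq
    exact hq rfl
  rw [eval_mul, eval_mul] at h1
  rw [RatFunc.eval, eval₂_id, eval₂_id, div_eq_div_iff h2 hq, h1]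

theorem eventually_eval_ne_zero {p : Polynomial ℂ} (hp : p ≠ 0) :
    ∀ᶠ z in 𝓝[≠] (0 : ℂ), p.eval z ≠ 0 := by
  have hfin : ({z | p.IsRoot z} \ {0}).Finite :=
    (Polynomial.finite_setOfPred_isRoot hp).subset Set.sdiff_subset
  have h0 : ∀ᶠ z in 𝓝 (0 : ℂ), z ∉ ({z | p.IsRoot z} \ {0}) :=
    hfin.isClosed.isOpen_compl.mem_nhds fun h => h.2 rfl
  filter_upwards [nhdsWithin_le_nhds h0, self_mem_nhdsWithin] with z hz hz0 h
  exact hz ⟨h, hz0⟩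

/-- Evaluation is multiplicative only away from the zeros of the denominators, which a small
punctured disc around 0 avoids. -/
theorem eventually_eval_prod_eq {ι : Type*} (s : Finset ι) (R : ι → RatFunc ℂ) :
    ∀ᶠ z in 𝓝[≠] (0 : ℂ), (∏ i ∈ s, R i).eval (RingHom.id ℂ) z
      = ∏ i ∈ s, (R i).eval (RingHom.id ℂ) z := by
  classical
  induction s using Finset.induction_on with
  | empty => simp
  | insert i s hi ih =>
    filter_upwards [ih, eventually_eval_ne_zero (RatFunc.denom_ne_zero (R i)),
      eventually_eval_ne_zero (RatFunc.denom_ne_zero (∏ i ∈ s, R i))] with z hz h1 h2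
    rw [Finset.prod_insert hi, Finset.prod_insert hi, RatFunc.eval_mul (f := RingHom.id ℂ) (a := z)
      (by rwa [Polynomial.eval₂_id]) (by rwa [Polynomial.eval₂_id]), hz]

-- After multiplication by z^N the series is a polynomial of degree below M = N + J plus the
-- geometric tail c_M z^M / (1 - αz).
open Polynomial in
theorem exists_ratFunc_hasSum {g : ℤ → ℂ} {α : ℂ} {N J : ℕ} (h0 : ∀ m : ℤ, m < -N → g m = 0)
    (h1 : ∀ m : ℤ, J ≤ m → g (m + 1) = α * g m) :
    ∃ (R : RatFunc ℂ) (ε : ℝ), 0 < ε ∧ ∀ z : ℂ, 0 < ‖z‖ → ‖z‖ < ε →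
      HasSum (fun m : ℤ => z ^ m * g m) (R.eval (RingHom.id ℂ) z) := by
  set c : ℕ → ℂ := fun j => g (j - N) with hc
  set M := N + J with hM
  have hcM : ∀ i : ℕ, c (i + M) = α ^ i * c M := by
    intro i
    induction i with
    | zero => simp
    | succ i ih =>
      have := h1 ((i + M : ℕ) - N) (by push_cast [hM]; linarith [Int.natCast_nonneg i])
      have e : ((i + 1 + M : ℕ) : ℤ) - N = ((i + M : ℕ) : ℤ) - N + 1 := by push_cast; ring
      simp only [hc] at ih ⊢
      rw [e, this, ih]
      ring
  set Q : ℂ[X] := (∑ j ∈ Finset.range M, C (c j) * X ^ j) * (1 - C α * X) + C (c M) * X ^ M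
  set D : ℂ[X] := X ^ N * (1 - C α * X) with hD
  refine ⟨algebraMap ℂ[X] (RatFunc ℂ) Q / algebraMap ℂ[X] (RatFunc ℂ) D, (‖α‖ + 1)⁻¹,
    by positivity, fun z hz hz' => ?_⟩
  have hz0 : z ≠ 0 := norm_pos_iff.1 hz
  have hαz : ‖α * z‖ < 1 := by
    rw [norm_mul]
    rw [lt_inv_comm₀ hz (by positivity)] at hz'
    have : (‖α‖ + 1) * ‖z‖ < 1 := by
      have := mul_lt_mul_of_pos_right hz' hz
      rwa [inv_mul_cancel₀ hz.ne'] at this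
    nlinarith
  have hne : 1 - α * z ≠ 0 := by
    intro h
    rw [← sub_eq_zero.1 h, norm_one] at hαz
    exact lt_irrefl _ hαz
  have hDz : D.eval z = z ^ N * (1 - α * z) := by simp [hD]
  have hQz : Q.eval z = (∑ j ∈ Finset.range M, c j * z ^ j) * (1 - α * z) + c M * z ^ M := by
    simp [Q, eval_finsetSum]
  rw [eval_ratFunc_div (by rw [hDz]; exact mul_ne_zero (pow_ne_zero _ hz0) hne), hDz, hQz]
  have hs1 : HasSum (fun i : ℕ => c (i + M) * z ^ (i + M)) (c M * z ^ M * (1 - α * z)⁻¹) := by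
    refine ((hasSum_geometric_of_norm_lt_one hαz).mul_left (c M * z ^ M)).congr_fun fun i => ?_
    rw [hcM, mul_pow, pow_add]
    ring
  have hs2 := ((hasSum_nat_add_iff (f := fun j : ℕ => c j * z ^ j) M).1 hs1).mul_left ((z ^ N)⁻¹)
  have hinj : Function.Injective fun j : ℕ => (j : ℤ) - N := fun i j hij => by
    simpa using hij
  rw [← hinj.hasSum_iff]
  · have hv : ((∑ j ∈ Finset.range M, c j * z ^ j) * (1 - α * z) + c M * z ^ M) /
        (z ^ N * (1 - α * z)) = (z ^ N)⁻¹ * (c M * z ^ M * (1 - α * z)⁻¹ +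
          ∑ i ∈ Finset.range M, c i * z ^ i) := by
      have h2 := pow_ne_zero N hz0
      generalize 1 - α * z = y at hne
      generalize z ^ N = x at h2
      field_simp
      ring
    rw [hv]
    refine hs2.congr_fun fun j => ?_
    simp only [Function.comp_apply, hc, zpow_sub₀ hz0, zpow_natCast]
    rw [div_eq_inv_mul, mul_assoc, mul_comm (z ^ j)]
  · intro m hm
    rw [h0 m, mul_zero]
    by_contra hcon
    exact hm ⟨(m + N).toNat, by simp only; omega⟩

end RationalFunctions

/-! ### The one-variable gamma function -/

section OneVariable

variable {F : Type*} [NontriviallyNormedField F] [IsUltrametricDist F] {ϖ : F}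
  {ψ : AddChar F Circle} {χ : Fˣ →* ℂˣ}

theorem exists_addChar_eq_one (hψ : Continuous ψ) :
    ∃ ε : ℝ, 0 < ε ∧ ∀ x : F, ‖x‖ ≤ ε → ψ x = 1 := by
  have hc : Continuous fun x : F => ‖(ψ x : ℂ) - 1‖ :=
    ((continuous_induced_dom.comp hψ).sub continuous_const).norm
  have hV : ∀ᶠ x in 𝓝 (0 : F), ‖(ψ x : ℂ) - 1‖ < 1 / 2 :=
    (hc.tendsto 0).eventually_lt_const (by simp)
  obtain ⟨ε, hε, hb⟩ := Metric.nhds_basis_closedBall.mem_iff.1 hV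
  refine ⟨ε, hε, fun x hx => Circle.ext (eq_one_of_norm_pow_sub_one_le fun n => ?_)⟩
  -- Integers have norm at most 1, so a ball around 0 is closed under multiples and ψ has no room
  -- for non-trivial values on it.
  have hn : ‖n • x‖ ≤ ε := by
    rw [nsmul_eq_mul, norm_mul]
    exact (mul_le_of_le_one_left (norm_nonneg _)
      (IsUltrametricDist.norm_natCast_le_one F n)).trans hx
  have := hb (mem_closedBall_zero_iff.2 hn)
  rw [Set.mem_ofPred_eq, AddChar.map_nsmul_eq_pow, Circle.coe_pow] at this
  exact this.le

variable [MeasurableSpace F] [BorelSpace F] [ProperSpace F] (μ : Measure F) [μ.IsAddHaarMeasure]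

/-- The integral of `χ ψ` over the shell `|t| = |ϖ| ^ m`. -/
noncomputable def shellIntegral (ψ : AddChar F Circle) (ϖ : F) (χ : Fˣ →* ℂˣ) (m : ℤ) : ℂ :=
  ∫ t in shell ϖ m, ((χ t : ℂˣ) : ℂ) * (ψ (t : F) : ℂ) ∂unitsMeasure μ

theorem shellIntegral_eq_zero (hψ : Continuous ψ) (hχ : Continuous fun t => ((χ t : ℂˣ) : ℂ))
    {η : ℝ≥0} (hη : ∀ u ∈ principalUnits F η, χ u = 1) {a : F} {R : ℝ} (ha : ‖a‖ ≤ R)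
    (haη : ‖a‖ ≤ η * R) (hψa : ψ a ≠ 1) {m : ℤ} (hm : R < ‖ϖ‖ ^ m) :
    shellIntegral μ ψ ϖ χ m = 0 := by
  have hc : Continuous fun t : Fˣ => ((χ t : ℂˣ) : ℂ) * (ψ (t : F) : ℂ) :=
    hχ.mul (continuous_induced_dom.comp (hψ.comp Units.continuous_val))
  have hms := measurableSet_shell ϖ m
  rw [shellIntegral, ← integral_indicator hms]
  refine integral_eq_zero_of_comp_eq_mul (measurePreserving_shift (R := R) (a := a) μ ha)
    (hc.measurable.indicator hms).aestronglyMeasurable (c := ψ a)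
    (fun h => hψa (Circle.ext h)) fun t => ?_
  have hiff : shift R a t ∈ shell ϖ m ↔ t ∈ shell ϖ m := by
    rw [mem_shell, norm_shift ha, mem_shell]
  by_cases ht : t ∈ shell ϖ m
  · have htR : R < ‖(t : F)‖ := by rwa [mem_shell.1 ht]
    rw [Set.indicator_of_mem ht, Set.indicator_of_mem (hiff.2 ht), shift_of_lt ha htR]
    obtain ⟨u, hu, hut⟩ := exists_shift_eq_mul ha haη t
    rw [hut, map_mul, hη u hu, mul_one, AddChar.map_add_eq_mul, Circle.coe_mul]
    ring
  · rw [Set.indicator_of_notMem ht, Set.indicator_of_notMem (mt hiff.1 ht), mul_zero]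

/-- Substitution t ↦ ϖt, once ψ is trivial on both shells: χ contributes χ(ϖ) and the measure
contributes δ. -/
theorem shellIntegral_succ (hϖ : IsUniformizer ϖ) {m : ℤ}
    (hm : ∀ x : F, ‖x‖ ≤ ‖ϖ‖ ^ m → ψ x = 1) :
    shellIntegral μ ψ ϖ χ (m + 1)
      = ((χ hϖ.unit : ℂˣ) : ℂ) * hϖ.modulus * shellIntegral μ ψ ϖ χ m := by
  have hδ : (hϖ.modulus : ℂ) ≠ 0 := by exact_mod_cast hϖ.modulus_pos.ne'
  have hle : ‖ϖ‖ ^ (m + 1) ≤ ‖ϖ‖ ^ m :=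
    zpow_le_zpow_right_of_le_one₀ hϖ.norm_pos hϖ.2.1.le (by linarith)
  have h := integral_mul_left_unitsMeasure μ hϖ.unit
    ((shell ϖ (m + 1)).indicator fun t => ((χ t : ℂˣ) : ℂ) * (ψ (t : F) : ℂ))
  have e : ∀ t : Fˣ, (shell ϖ (m + 1)).indicator (fun t => ((χ t : ℂˣ) : ℂ) * (ψ (t : F) : ℂ))
      (hϖ.unit * t) = ((χ hϖ.unit : ℂˣ) : ℂ) *
        (shell ϖ m).indicator (fun t => ((χ t : ℂˣ) : ℂ) * (ψ (t : F) : ℂ)) t := by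
    intro t
    have hpre := hϖ.preimage_shell 1 (m + 1)
    rw [zpow_one, add_sub_cancel_right] at hpre
    have hiff : hϖ.unit * t ∈ shell ϖ (m + 1) ↔ t ∈ shell ϖ m := by
      rw [← hpre]
      rfl
    by_cases ht : t ∈ shell ϖ m
    · rw [Set.indicator_of_mem ht, Set.indicator_of_mem (hiff.2 ht), hm t (mem_shell.1 ht).le,
        hm _ ((mem_shell.1 (hiff.2 ht)).le.trans hle), map_mul, Units.val_mul, mul_assoc]
    · rw [Set.indicator_of_notMem ht, Set.indicator_of_notMem (mt hiff.1 ht), mul_zero]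
  simp_rw [e] at h
  rw [integral_const_mul, integral_indicator (measurableSet_shell _ _),
    integral_indicator (measurableSet_shell _ _)] at h
  change ((χ hϖ.unit : ℂˣ) : ℂ) * shellIntegral μ ψ ϖ χ m
    = (hϖ.modulus : ℂ)⁻¹ * shellIntegral μ ψ ϖ χ (m + 1) at h
  rw [mul_right_comm, h, mul_comm _ (hϖ.modulus : ℂ), mul_inv_cancel_left₀ hδ]

theorem exists_isGammaFactor (hϖ : IsUniformizer ϖ) (hψ : Continuous ψ) (hψ1 : ψ ≠ 1)
    (hχ : Continuous fun t => ((χ t : ℂˣ) : ℂ)) {η : ℝ≥0} (hη0 : 0 < η)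
    (hη : ∀ u ∈ principalUnits F η, χ u = 1) : ∃ R : RatFunc ℂ, IsGammaFactor ψ μ ϖ χ R := by
  obtain ⟨a, ha⟩ := AddChar.ne_one_iff.1 hψ1
  obtain ⟨r, hr⟩ := exists_radius a hη0
  obtain ⟨ε, hε, hε1⟩ := exists_addChar_eq_one hψ
  obtain ⟨N, hN⟩ := pow_unbounded_of_one_lt r ((one_lt_inv₀ hϖ.norm_pos).2 hϖ.2.1)
  obtain ⟨J, hJ⟩ := exists_pow_lt_of_lt_one hε hϖ.2.1
  refine exists_ratFunc_hasSum (g := shellIntegral μ ψ ϖ χ) (N := N) (J := J)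
    (α := ((χ hϖ.unit : ℂˣ) : ℂ) * hϖ.modulus) (fun m hm => ?_) fun m hm => ?_
  · refine shellIntegral_eq_zero μ hψ hχ hη (hr r le_rfl).1 (hr r le_rfl).2 ha (hN.trans ?_)
    rw [← zpow_natCast, inv_zpow']
    exact zpow_lt_zpow_right_of_lt_one₀ hϖ.norm_pos hϖ.2.1 hm
  · refine shellIntegral_succ μ hϖ fun x hx => hε1 x (hx.trans (le_trans ?_ hJ.le))
    rw [← zpow_natCast]
    exact zpow_le_zpow_right_of_le_one₀ hϖ.norm_pos hϖ.2.1.le hm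

theorem summable_ite_zpow {β : ℝ} (h0 : 0 < β) (h1 : β < 1) (B : ℝ) (m₀ : ℤ) :
    Summable fun m : ℤ => if m₀ ≤ m then B * β ^ m else 0 := by
  have hinj : Function.Injective fun j : ℕ => (j : ℤ) + m₀ := fun i j hij => by
    simpa using hij
  rw [← hinj.summable_iff]
  · refine ((summable_geometric_of_lt_one h0.le h1).mul_left (B * β ^ m₀)).congr fun j => ?_
    rw [Function.comp_apply, if_pos (by omega), zpow_add₀ h0.ne', zpow_natCast]
    ring
  · intro m hm
    rw [if_neg]
    exact fun h => hm ⟨(m - m₀).toNat, by simp only; omega⟩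

theorem ofReal_zpow_cpow {q : ℝ} (hq : 0 < q) (m : ℤ) (s : ℂ) :
    (((q ^ m : ℝ)) : ℂ) ^ s = ((q : ℂ) ^ s) ^ m := by
  have hq' : (q : ℂ) ≠ 0 := by exact_mod_cast hq.ne'
  have hqm : ((q ^ m : ℝ) : ℂ) ≠ 0 := by exact_mod_cast (zpow_pos hq m).ne'
  rw [Complex.cpow_def_of_ne_zero hqm, Complex.cpow_def_of_ne_zero hq', ← Complex.ofReal_log
    (zpow_pos hq m).le, Real.log_zpow, ← Complex.ofReal_log hq.le, ← Complex.exp_int_mul]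
  push_cast
  ring_nf

/-- χ is bounded on the compact unit shell, and every other shell is the translate of it by a power
of ϖ. -/
theorem exists_norm_char_le (hϖ : IsUniformizer ϖ) (hχ : Continuous fun t => ((χ t : ℂˣ) : ℂ)) :
    ∃ B : ℝ, 0 ≤ B ∧ ∀ (m : ℤ), ∀ t ∈ shell ϖ m,
      ‖((χ t : ℂˣ) : ℂ)‖ ≤ B * ‖((χ hϖ.unit : ℂˣ) : ℂ)‖ ^ m := by
  have hcomp : IsCompact (shell ϖ 0) := by
    have : shell ϖ 0 = {t : Fˣ | 1 ≤ ‖(t : F)‖ ∧ ‖(t : F)‖ ≤ 1} :=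
      Set.ext fun t => by
        rw [mem_shell, zpow_zero]
        exact ⟨fun h => ⟨h.ge, h.le⟩, fun h => le_antisymm h.2 h.1⟩
    rw [this]
    exact isCompact_norm_mem_Icc one_pos
  obtain ⟨B, hB⟩ := hcomp.exists_bound_of_continuousOn hχ.continuousOn
  refine ⟨B, (norm_nonneg _).trans (hB 1 (by simp [mem_shell])), fun m t ht => ?_⟩
  have hu : hϖ.unit ^ (-m) * t ∈ shell ϖ 0 := by
    rw [← Set.mem_preimage, hϖ.preimage_shell, zero_sub, neg_neg]
    exact ht
  have h1 : t = hϖ.unit ^ (-m) * t * hϖ.unit ^ m := by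
    rw [mul_right_comm, ← zpow_add, neg_add_cancel, zpow_zero, one_mul]
  rw [h1, map_mul, Units.val_mul, norm_mul, map_zpow, Units.val_zpow_eq_zpow_val, norm_zpow]
  exact mul_le_mul_of_nonneg_right (hB _ hu) (zpow_nonneg (norm_nonneg _) _)

theorem continuous_norm_cpow (s : ℂ) : Continuous fun t : Fˣ => ((‖(t : F)‖ : ℝ) : ℂ) ^ s := by
  rw [continuous_iff_continuousAt]
  intro t
  exact ContinuousAt.comp (f := fun t : Fˣ => ‖(t : F)‖) (g := fun x : ℝ => (x : ℂ) ^ s)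
    (Complex.continuousAt_ofReal_cpow_const _ _ (Or.inr (norm_ne_zero_iff.2 t.ne_zero)))
    continuous_norm_val.continuousAt

theorem integrableOn_char_cpow (hϖ : IsUniformizer ϖ) (hψ : Continuous ψ)
    (hχ : Continuous fun t => ((χ t : ℂˣ) : ℂ)) (R : ℝ) {s : ℂ}
    (hs : ‖((χ hϖ.unit : ℂˣ) : ℂ)‖ * ‖(‖ϖ‖ : ℂ) ^ s‖ * hϖ.modulus < 1) :
    IntegrableOn (fun t : Fˣ => ((χ t : ℂˣ) : ℂ) * ((‖(t : F)‖ : ℝ) : ℂ) ^ s * (ψ (t : F) : ℂ))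
      {t | ‖(t : F)‖ ≤ R} (unitsMeasure μ) := by
  have hq0 := hϖ.norm_pos
  have hm : MeasurableSet {t : Fˣ | ‖(t : F)‖ ≤ R} := measurable_norm_val measurableSet_Iic
  have hc : Continuous fun t : Fˣ =>
      ((χ t : ℂˣ) : ℂ) * ((‖(t : F)‖ : ℝ) : ℂ) ^ s * (ψ (t : F) : ℂ) :=
    (hχ.mul (continuous_norm_cpow s)).mul
      (continuous_induced_dom.comp (hψ.comp Units.continuous_val))
  obtain ⟨B, hB0, hB⟩ := exists_norm_char_le hϖ hχ
  obtain ⟨N, hN⟩ := pow_unbounded_of_one_lt R ((one_lt_inv₀ hq0).2 hϖ.2.1)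
  have hβ : 0 < ‖((χ hϖ.unit : ℂˣ) : ℂ)‖ * ‖(‖ϖ‖ : ℂ) ^ s‖ * hϖ.modulus := by
    refine mul_pos (mul_pos (norm_pos_iff.2 (Units.ne_zero _)) (norm_pos_iff.2 ?_)) hϖ.modulus_pos
    rw [Complex.cpow_ne_zero_iff]
    exact Or.inl (by exact_mod_cast hq0.ne')
  rw [← integrable_indicator_iff hm]
  refine integrable_of_norm_le_shell μ hϖ (hc.measurable.indicator hm).aestronglyMeasurable
    (b := fun m => if -(N : ℤ) ≤ m then
      B * (‖((χ hϖ.unit : ℂˣ) : ℂ)‖ ^ m * ‖(‖ϖ‖ : ℂ) ^ s‖ ^ m) else 0) (fun m t ht => ?_) ?_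
  · have htn : ‖(t : F)‖ = ‖ϖ‖ ^ m := ht
    by_cases hR : ‖(t : F)‖ ≤ R
    · rw [Set.indicator_of_mem (show t ∈ {t : Fˣ | ‖(t : F)‖ ≤ R} from hR), if_pos]
      · rw [norm_mul, norm_mul, Circle.norm_coe, mul_one, htn, ofReal_zpow_cpow hq0, norm_zpow,
          ← mul_assoc]
        exact mul_le_mul_of_nonneg_right (hB m t ht) (zpow_nonneg (norm_nonneg _) _)
      · have h3 : ‖ϖ‖ ^ m < ‖ϖ‖ ^ (-(N : ℤ)) := by
          rw [zpow_neg, zpow_natCast, ← inv_pow, ← htn]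
          exact hR.trans_lt hN
        exact ((zpow_lt_zpow_iff_right_of_lt_one₀ hq0 hϖ.2.1).1 h3).le
    · rw [Set.indicator_of_notMem (show t ∉ {t : Fˣ | ‖(t : F)‖ ≤ R} from hR), norm_zero]
      split_ifs
      · positivity
      · exact le_rfl
  · refine (summable_ite_zpow hβ hs B (-(N : ℤ))).congr fun m => ?_
    split_ifs
    · rw [mul_zpow, mul_zpow]
      ring
    · rw [zero_mul]

/-- The shells with |ϖ|^m ≤ R decompose an absolutely convergent integral, and the shift kills the
others. The sum over shells is therefore a genuine integral over a ball. -/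
theorem hasSum_shellIntegral (hϖ : IsUniformizer ϖ) (hψ : Continuous ψ)
    (hχ : Continuous fun t => ((χ t : ℂˣ) : ℂ)) {η : ℝ≥0}
    (hη : ∀ u ∈ principalUnits F η, χ u = 1) {a : F} {R : ℝ} (ha : ‖a‖ ≤ R)
    (haη : ‖a‖ ≤ η * R) (hψa : ψ a ≠ 1) {s : ℂ}
    (hs : ‖((χ hϖ.unit : ℂˣ) : ℂ)‖ * ‖(‖ϖ‖ : ℂ) ^ s‖ * hϖ.modulus < 1) :
    HasSum (fun m : ℤ => ((‖ϖ‖ : ℂ) ^ s) ^ m * shellIntegral μ ψ ϖ χ m)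
      (∫ t in {t : Fˣ | ‖(t : F)‖ ≤ R},
        ((χ t : ℂˣ) : ℂ) * ((‖(t : F)‖ : ℝ) : ℂ) ^ s * (ψ (t : F) : ℂ) ∂unitsMeasure μ) := by
  have hq0 := hϖ.norm_pos
  have hm : MeasurableSet {t : Fˣ | ‖(t : F)‖ ≤ R} := measurable_norm_val measurableSet_Iic
  have hint := integrableOn_char_cpow μ hϖ hψ hχ R hs
  rw [← integrable_indicator_iff hm] at hint
  have h := hasSum_integral_iUnion (μ := unitsMeasure μ) (measurableSet_shell ϖ)
    hϖ.pairwise_disjoint_shell (by rw [hϖ.iUnion_shell]; exact hint.integrableOn)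
  rw [hϖ.iUnion_shell, setIntegral_univ, integral_indicator hm] at h
  refine h.congr_fun fun m => ?_
  by_cases hR : ‖ϖ‖ ^ m ≤ R
  · rw [shellIntegral, ← integral_const_mul]
    refine setIntegral_congr_fun (measurableSet_shell ϖ m) fun t ht => ?_
    have htn : ‖(t : F)‖ = ‖ϖ‖ ^ m := ht
    rw [Set.indicator_of_mem (show t ∈ {t : Fˣ | ‖(t : F)‖ ≤ R} from htn.le.trans hR), htn,
      ofReal_zpow_cpow hq0]
    ring
  · rw [shellIntegral_eq_zero μ hψ hχ hη ha haη hψa (not_le.1 hR), mul_zero]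
    symm
    refine setIntegral_eq_zero_of_forall_eq_zero fun t ht => ?_
    have htn : ‖(t : F)‖ = ‖ϖ‖ ^ m := ht
    exact Set.indicator_of_notMem
      (show t ∉ {t : Fˣ | ‖(t : F)‖ ≤ R} from fun h => hR (htn ▸ h)) _

/-- The range of z does not depend on a or R. This uniformity matters because R is later chosen in
terms of an arbitrary subgroup K, after s has been fixed. -/
theorem IsGammaFactor.eventually_eq (hϖ : IsUniformizer ϖ) (hψ : Continuous ψ)
    (hχ : Continuous fun t => ((χ t : ℂˣ) : ℂ)) {η : ℝ≥0}
    (hη : ∀ u ∈ principalUnits F η, χ u = 1) {r : RatFunc ℂ} (hr : IsGammaFactor ψ μ ϖ χ r) :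
    ∀ᶠ z in 𝓝[≠] (0 : ℂ), ∀ s : ℂ, (‖ϖ‖ : ℂ) ^ s = z →
      ∀ (a : F) (R : ℝ), ‖a‖ ≤ R → ‖a‖ ≤ η * R → ψ a ≠ 1 →
      IntegrableOn (fun t : Fˣ => ((χ t : ℂˣ) : ℂ) * ((‖(t : F)‖ : ℝ) : ℂ) ^ s * (ψ (t : F) : ℂ))
        {t | ‖(t : F)‖ ≤ R} (unitsMeasure μ) ∧
      ∫ t in {t : Fˣ | ‖(t : F)‖ ≤ R},
        ((χ t : ℂˣ) : ℂ) * ((‖(t : F)‖ : ℝ) : ℂ) ^ s * (ψ (t : F) : ℂ) ∂unitsMeasure μ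
        = r.eval (RingHom.id ℂ) z := by
  obtain ⟨ε, hε, h⟩ := hr
  have hsmall : ∀ᶠ z in 𝓝 (0 : ℂ),
      ‖((χ hϖ.unit : ℂˣ) : ℂ)‖ * ‖z‖ * hϖ.modulus < 1 := by
    have hc : Continuous fun z : ℂ => ‖((χ hϖ.unit : ℂˣ) : ℂ)‖ * ‖z‖ * hϖ.modulus := by fun_prop
    exact (hc.tendsto 0).eventually_lt_const (by simp)
  have hb : ∀ᶠ z in 𝓝 (0 : ℂ), ‖z‖ < ε :=
    (continuous_norm.tendsto (0 : ℂ)).eventually_lt_const (by simpa using hε)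
  filter_upwards [nhdsWithin_le_nhds hsmall, nhdsWithin_le_nhds hb, self_mem_nhdsWithin]
    with z h1 h2 h3 s hs a R ha haη hψa
  subst hs
  exact ⟨integrableOn_char_cpow μ hϖ hψ hχ R h1,
    (hasSum_shellIntegral μ hϖ hψ hχ hη ha haη hψa h1).unique
      (h _ (norm_pos_iff.2 h3) h2)⟩

end OneVariable

/-! ### Compact open subgroups of T -/

section OpenSubgroups

variable {F : Type*} [NontriviallyNormedField F] [IsUltrametricDist F] {d : ℕ}

/-- The open subgroup of `T` of elements all of whose coordinates lie in `principalUnits F η`. -/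
def principalTorus (F : Type*) [NontriviallyNormedField F] [IsUltrametricDist F] (d : ℕ)
    {η : ℝ≥0} (hη : 0 < η) : OpenSubgroup (Torus F d) where
  toSubgroup := Subgroup.pi Set.univ fun _ => principalUnits F η
  isOpen' := by
    refine Subgroup.isOpen_of_mem_nhds _ (g := 1) ?_
    filter_upwards [eventually_forall_mem_principalUnits (F := F) (d := d) hη] with k hk j _
    exact hk j

theorem mem_principalTorus {η : ℝ≥0} (hη : 0 < η) {k : Torus F d} :
    k ∈ principalTorus F d hη ↔ ∀ j, k j ∈ principalUnits F η :=
  ⟨fun h j => h j trivial, fun h j _ => h j⟩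

theorem isCompact_pi_norm_mem_Icc [ProperSpace F] {a b : ℝ} (ha : 0 < a) :
    IsCompact {t : Torus F d | ∀ j, a ≤ ‖(t j : F)‖ ∧ ‖(t j : F)‖ ≤ b} := by
  have : {t : Torus F d | ∀ j, a ≤ ‖(t j : F)‖ ∧ ‖(t j : F)‖ ≤ b}
      = Set.univ.pi fun _ => {t : Fˣ | a ≤ ‖(t : F)‖ ∧ ‖(t : F)‖ ≤ b} := by
    ext t
    rw [Set.mem_univ_pi]
    rfl
  rw [this]
  exact isCompact_univ_pi fun _ => isCompact_norm_mem_Icc ha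

theorem isCompact_principalTorus [ProperSpace F] {η : ℝ≥0} (hη : 0 < η) :
    IsCompact (principalTorus F d hη : Set (Torus F d)) := by
  refine (isCompact_pi_norm_mem_Icc (F := F) (d := d) (b := 1) one_pos).of_isClosed_subset
    (principalTorus F d hη).isClosed fun k hk j => ?_
  have := ((mem_principalTorus hη).1 hk j).1
  exact ⟨this.ge, this.le⟩

theorem countable_quotient_openSubgroup {T : Type*} [CommGroup T] [TopologicalSpace T]
    [IsTopologicalGroup T] [SecondCountableTopology T] (K : OpenSubgroup T) :
    Countable (T ⧸ (K : Subgroup T)) := by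
  have : DiscreteTopology (T ⧸ (K : Subgroup T)) := QuotientGroup.discreteTopology K.isOpen
  have : TopologicalSpace.SeparableSpace (T ⧸ (K : Subgroup T)) :=
    QuotientGroup.isOpenQuotientMap_mk.isQuotientMap.separableSpace
  exact TopologicalSpace.separableSpace_iff_countable.1 this

theorem norm_char_eq_one {sig : Fin d → ℤ} {k : Torus F d} (hk : ∀ j, ‖(k j : F)‖ = 1) :
    ‖((char F sig k : Fˣ) : F)‖ = 1 := by
  change ‖((∏ j, k j ^ sig j : Fˣ) : F)‖ = 1
  rw [Units.coe_prod, norm_prod]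
  refine Finset.prod_eq_one fun j _ => ?_
  rw [Units.val_zpow_eq_zpow_val, norm_zpow, hk, one_zpow]

end OpenSubgroups

/-! ### Scaling of absolutely convergent integrals -/

section HasIntegral

variable {T : Type*} [CommGroup T] [TopologicalSpace T] [IsTopologicalGroup T] [T2Space T]

theorem HasIntegral.const_mul {Φ : Distribution T} {f : T → ℂ} {a c : ℂ} (h : HasIntegral Φ f a)
    (hc : c ≠ 0) : HasIntegral Φ (fun x => c * f x) (c * a) := by
  obtain ⟨⟨K₀, hK₀, hi₀⟩, h2⟩ := h
  refine ⟨⟨K₀, hK₀, fun x k hk => congrArg (c * ·) (hi₀ x k hk)⟩, fun K hK hi => ?_⟩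
  obtain ⟨h3, h4⟩ := h2 K hK fun x k hk => mul_left_cancel₀ hc (hi x k hk)
  refine ⟨(h3.mul_left ‖c‖).congr fun x => ?_, (h4.mul_left c).congr_fun fun x => ?_⟩
  · rw [mul_assoc, norm_mul c]
  · rw [mul_assoc]

end HasIntegral

/-! ### The integral of θ|σ|^s against Φ_ρ -/

section Twist

variable {F : Type*} [NontriviallyNormedField F] [IsUltrametricDist F] {n d : ℕ}
  {sig : Fin d → ℤ} {θ : Torus F d →ₜ* ℂˣ} {s : ℂ} {lam : Fin n → Fin d → ℤ}

/-- The function `θ|σ|^s` as a homomorphism. -/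
noncomputable def twistHom (sig : Fin d → ℤ) (θ : Torus F d →ₜ* ℂˣ) (s : ℂ) :
    Torus F d →* ℂ where
  toFun := twist sig θ s
  map_one' := by simp [twist]
  map_mul' x y := by
    rw [twist, twist, twist, map_mul, map_mul, Units.val_mul, Units.val_mul, norm_mul,
      Complex.ofReal_mul, Complex.mul_cpow_ofReal_nonneg (norm_nonneg _) (norm_nonneg _)]
    ring

theorem twistHom_apply (x : Torus F d) : twistHom sig θ s x = twist sig θ s x := rfl

theorem twist_mul (x y : Torus F d) :
    twist sig θ s (x * y) = twist sig θ s x * twist sig θ s y := map_mul (twistHom sig θ s) x y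

theorem twist_inv_mul_self (x : Torus F d) : twist sig θ s x⁻¹ * twist sig θ s x = 1 := by
  rw [← twist_mul, inv_mul_cancel]
  exact map_one (twistHom sig θ s)

theorem twist_ne_zero (x : Torus F d) : twist sig θ s x ≠ 0 :=
  right_ne_zero_of_mul_eq_one (twist_inv_mul_self x)

theorem twist_inv (x : Torus F d) : (twist sig θ s x⁻¹)⁻¹ = twist sig θ s x :=
  inv_eq_of_mul_eq_one_right (twist_inv_mul_self x)

/-- The character `θ ∘ λ` of `Fˣ`. -/
noncomputable def compCochar (θ : Torus F d →ₜ* ℂˣ) (l : Fin d → ℤ) : Fˣ →* ℂˣ :=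
  (θ : Torus F d →* ℂˣ).comp (cochar F l)

theorem compCochar_apply (l : Fin d → ℤ) (t : Fˣ) : compCochar θ l t = θ (cochar F l t) := rfl

theorem continuous_compCochar (l : Fin d → ℤ) :
    Continuous fun t => ((compCochar θ l t : ℂˣ) : ℂ) :=
  Units.continuous_val.comp (θ.continuous_toFun.comp (continuous_cochar l))

theorem IsAdmissible.twist_pRho (hρ : IsAdmissible lam sig) (t : Torus F n) :
    twist sig θ s (pRho F lam t)
      = ∏ i, ((compCochar θ (lam i) (t i) : ℂˣ) : ℂ) * ((‖(t i : F)‖ : ℝ) : ℂ) ^ s := by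
  rw [← twistHom_apply, pRho_eq_prod, map_prod]
  refine Finset.prod_congr rfl fun i _ => ?_
  rw [twistHom_apply, twist, hρ.char_cochar_eq, compCochar_apply]

theorem coe_addChar_fRho {ψ : AddChar F Circle} (t : Torus F n) :
    (ψ (fRho t) : ℂ) = ∏ i, (ψ (t i : F) : ℂ) := by
  have : ∀ S : Finset (Fin n), (ψ (∑ i ∈ S, (t i : F)) : ℂ) = ∏ i ∈ S, (ψ (t i : F) : ℂ) := by
    intro S
    classical
    induction S using Finset.induction_on with
    | empty => simp
    | insert i S hi ih =>
      rw [Finset.sum_insert hi, Finset.prod_insert hi, AddChar.map_add_eq_mul, Circle.coe_mul, ih]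
  exact this _

variable [MeasurableSpace F] [BorelSpace F] [ProperSpace F] (μ : Measure F) [μ.IsAddHaarMeasure]
  {ψ : AddChar F Circle} {ϖ : F}

theorem prod_indicator_norm_le (R : ℝ) (g : Fin n → Fˣ → ℂ) (t : Torus F n) :
    ∏ i, {t : Fˣ | ‖(t : F)‖ ≤ R}.indicator (g i) (t i)
      = (box F n R).indicator (fun t => ∏ i, g i (t i)) t := by
  by_cases ht : t ∈ box F n R
  · rw [Set.indicator_of_mem ht]
    exact Finset.prod_congr rfl fun i _ => Set.indicator_of_mem (s := {t : Fˣ | ‖(t : F)‖ ≤ R})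
      (ht i) _
  · rw [Set.indicator_of_notMem ht]
    obtain ⟨i, hi⟩ := not_forall.1 (show ¬ ∀ i, ‖(t i : F)‖ ≤ R from ht)
    exact Finset.prod_eq_zero (Finset.mem_univ i) (Set.indicator_of_notMem
      (show t i ∉ {t : Fˣ | ‖(t : F)‖ ≤ R} from hi) _)

theorem integral_box_prod {R : ℝ} {g : Fin n → Fˣ → ℂ}
    (hg : ∀ i, IntegrableOn (g i) {t | ‖(t : F)‖ ≤ R} (unitsMeasure μ)) :
    IntegrableOn (fun t : Torus F n => ∏ i, g i (t i)) (box F n R) (omegaMeasure μ n) ∧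
    ∫ t in box F n R, ∏ i, g i (t i) ∂omegaMeasure μ n
      = ∏ i, ∫ t in {t : Fˣ | ‖(t : F)‖ ≤ R}, g i t ∂unitsMeasure μ := by
  have hm : MeasurableSet {t : Fˣ | ‖(t : F)‖ ≤ R} := measurable_norm_val measurableSet_Iic
  have hB := (isClosed_box (F := F) (n := n) R).measurableSet
  have e := funext (prod_indicator_norm_le (n := n) R g)
  constructor
  · rw [← integrable_indicator_iff hB, ← e]
    exact Integrable.fintype_prod fun i => (integrable_indicator_iff hm).2 (hg i)
  · rw [← integral_indicator hB, ← e]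
    simp_rw [← integral_indicator hm]
    exact integral_fintype_prod_eq_prod fun i => {t : Fˣ | ‖(t : F)‖ ≤ R}.indicator (g i)

/-- The box is the disjoint union of its intersections with the sets p_ρ⁻¹(hK). By the box formula,
the integral over each piece is the corresponding term of the series, since θ|σ|^s is constant on
hK. The integral over the whole box is the product of the one-variable integrals. -/
theorem IsLimitDistribution.hasIntegral_twist (hϖ : IsUniformizer ϖ) (hρ : IsAdmissible lam sig)
    (hψ : Continuous ψ) (hψ1 : ψ ≠ 1) {Φ : Distribution (Torus F d)}
    (hΦ : IsLimitDistribution ψ μ lam Φ) {η : ℝ≥0} (hη : 0 < η)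
    (hθ : ∀ k : Torus F d, (∀ j, k j ∈ principalUnits F η) → θ k = 1) {v : Fin n → ℂ}
    (h : ∀ i, ∀ (a : F) (R : ℝ), ‖a‖ ≤ R → ‖a‖ ≤ η * R → ψ a ≠ 1 →
      IntegrableOn (fun t : Fˣ => ((compCochar θ (lam i) t : ℂˣ) : ℂ) *
        ((‖(t : F)‖ : ℝ) : ℂ) ^ s * (ψ (t : F) : ℂ)) {t | ‖(t : F)‖ ≤ R} (unitsMeasure μ) ∧
      ∫ t in {t : Fˣ | ‖(t : F)‖ ≤ R}, ((compCochar θ (lam i) t : ℂˣ) : ℂ) *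
        ((‖(t : F)‖ : ℝ) : ℂ) ^ s * (ψ (t : F) : ℂ) ∂unitsMeasure μ = v i) :
    HasIntegral Φ (twist sig θ s) (∏ i, v i) := by
  obtain ⟨a, ha⟩ := AddChar.ne_one_iff.1 hψ1
  refine ⟨⟨principalTorus F d hη, isCompact_principalTorus hη, fun x k hk => ?_⟩,
    fun K hK hinv => ?_⟩
  · have hk' := (mem_principalTorus hη).1 hk
    rw [twist_mul, twist, twist, hθ k hk', norm_char_eq_one fun j => (hk' j).1]
    simp
  · obtain ⟨η', hη', hK'⟩ := exists_forall_principalUnits_of_mem_nhds (K.isOpen.mem_nhds K.one_mem)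
    obtain ⟨R₁, hR₁⟩ := exists_radius a hη
    obtain ⟨R₂, hR₂⟩ := exists_radius a hη'
    -- The radius must serve both the level `η` of θ, for the one-variable integrals, and the level
    -- `η'` of K, for the box formula applied to 1_{hK}.
    set R := max R₁ R₂
    have h1 := hR₁ R (le_max_left _ _)
    have h2 := hR₂ R (le_max_right _ _)
    have hval : ∀ t : Torus F n, twist sig θ s (pRho F lam t) * (ψ (fRho t) : ℂ)
        = ∏ i, ((compCochar θ (lam i) (t i) : ℂˣ) : ℂ) * ((‖(t i : F)‖ : ℝ) : ℂ) ^ s *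
          (ψ (t i : F) : ℂ) := fun t => by
      rw [hρ.twist_pRho, coe_addChar_fRho, ← Finset.prod_mul_distrib]
    obtain ⟨hint, hprod⟩ := integral_box_prod μ (R := R) (g := fun i t =>
      ((compCochar θ (lam i) t : ℂˣ) : ℂ) * ((‖(t : F)‖ : ℝ) : ℂ) ^ s * (ψ (t : F) : ℂ))
      fun i => (h i a R h1.1 h1.2 ha).1
    simp_rw [← hval] at hint hprod
    rw [Finset.prod_congr rfl fun i _ => (h i a R h1.1 h1.2 ha).2] at hprod
    have hcount := countable_quotient_openSubgroup K
    have hdisc : DiscreteTopology (Torus F d ⧸ (K : Subgroup (Torus F d))) :=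
      QuotientGroup.discreteTopology K.isOpen
    set S : Torus F d ⧸ (K : Subgroup (Torus F d)) → Set (Torus F n) := fun c =>
      box F n R ∩ {t | (pRho F lam t : Torus F d ⧸ (K : Subgroup (Torus F d))) = c}
    have hSm' : ∀ c : Torus F d ⧸ (K : Subgroup (Torus F d)), MeasurableSet
        {t : Torus F n | (pRho F lam t : Torus F d ⧸ (K : Subgroup (Torus F d))) = c} := fun c =>
      ((isOpen_discrete {c}).preimage
        (QuotientGroup.continuous_mk.comp (continuous_pRho lam))).measurableSet
    have hSm : ∀ c, MeasurableSet (S c) := fun c => (isClosed_box R).measurableSet.inter (hSm' c)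
    have hSd : Pairwise (Function.onFun Disjoint S) := fun c c' hcc => by
      rw [Function.onFun, Set.disjoint_left]
      exact fun t ht ht' => hcc (ht.2.symm.trans ht'.2)
    have hSu : ⋃ c, S c = box F n R := by
      ext t
      rw [Set.mem_iUnion]
      exact ⟨fun ⟨c, hc⟩ => hc.1, fun ht => ⟨_, ht, rfl⟩⟩
    have hsum := hasSum_integral_iUnion (μ := omegaMeasure μ n) hSm hSd (by rwa [hSu])
    rw [hSu, hprod] at hsum
    have hterm : ∀ c : Torus F d ⧸ (K : Subgroup (Torus F d)),
        twist sig θ s c.out * Φ (Test.coset K hK c)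
          = ∫ t in S c, twist sig θ s (pRho F lam t) * (ψ (fRho t) : ℂ) ∂omegaMeasure μ n := by
      intro c
      rw [hΦ.apply_eq μ hϖ hρ hψ _ (isInv_indicator_one hK' c) h2.1 h2.2 ha,
        ← integral_const_mul, ← setIntegral_indicator (hSm' c)]
      refine integral_congr_ae (Eventually.of_forall fun t => ?_)
      change twist sig θ s c.out * (((fun h : Torus F d =>
        (h : Torus F d ⧸ (K : Subgroup (Torus F d)))) ⁻¹' {c}).indicator 1 (pRho F lam t) *
          (ψ (fRho t) : ℂ)) = _
      by_cases ht : (pRho F lam t : Torus F d ⧸ (K : Subgroup (Torus F d))) = c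
      · rw [Set.indicator_of_mem (show t ∈ {t : Torus F n |
          (pRho F lam t : Torus F d ⧸ (K : Subgroup (Torus F d))) = c} from ht),
          Set.indicator_of_mem (show pRho F lam t ∈ (fun h : Torus F d =>
            (h : Torus F d ⧸ (K : Subgroup (Torus F d)))) ⁻¹' {c} from ht), Pi.one_apply, one_mul]
        have hk : (pRho F lam t)⁻¹ * c.out ∈ K := by
          refine QuotientGroup.eq.1 ?_
          rw [ht, QuotientGroup.out_eq']
        have := hinv (pRho F lam t) _ hk
        rw [mul_inv_cancel_left] at this
        rw [this]
      · rw [Set.indicator_of_notMem (show t ∉ {t : Torus F n |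
          (pRho F lam t : Torus F d ⧸ (K : Subgroup (Torus F d))) = c} from ht),
          Set.indicator_of_notMem (show pRho F lam t ∉ (fun h : Torus F d =>
            (h : Torus F d ⧸ (K : Subgroup (Torus F d)))) ⁻¹' {c} from ht), zero_mul, mul_zero]
    have hsum' := hsum.congr_fun hterm
    -- In ℂ unconditional summability is absolute summability.
    exact ⟨hsum'.summable.norm, hsum'⟩

theorem tendsto_cpow_nhdsNE (hϖ : IsUniformizer ϖ) :
    Tendsto (fun s : ℂ => (‖ϖ‖ : ℂ) ^ s) (comap Complex.re atTop) (𝓝[≠] 0) := by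
  have hq0 := hϖ.norm_pos
  refine tendsto_nhdsWithin_iff.2 ⟨?_, Eventually.of_forall fun s => ?_⟩
  · rw [tendsto_zero_iff_norm_tendsto_zero]
    have : ∀ s : ℂ, ‖(‖ϖ‖ : ℂ) ^ s‖ = ‖ϖ‖ ^ s.re := fun s =>
      Complex.norm_cpow_eq_rpow_re_of_pos hq0 s
    simp_rw [this]
    exact (tendsto_rpow_atTop_of_base_lt_one _ (by linarith) hϖ.2.1).comp tendsto_comap
  · rw [Set.mem_compl_iff, Set.mem_singleton_iff, Complex.cpow_eq_zero_iff, not_and_or]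
    exact Or.inl (by exact_mod_cast hq0.ne')

theorem IsLimitDistribution.exists_isTorusGamma (hϖ : IsUniformizer ϖ)
    (hρ : IsAdmissible lam sig) (hψ : Continuous ψ) (hψ1 : ψ ≠ 1) {Φ : Distribution (Torus F d)}
    (hΦ : IsLimitDistribution ψ μ lam Φ) (θ : Torus F d →ₜ* ℂˣ) :
    ∃ R : RatFunc ℂ, IsTorusGamma ψ μ ϖ lam θ R ∧
      ∃ s₀ : ℝ, ∀ s : ℂ, s₀ < s.re →
        HasIntegral Φ (twist sig θ s) (R.eval (RingHom.id ℂ) ((‖ϖ‖ : ℂ) ^ s)) := by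
  obtain ⟨η, hη, hθ⟩ := exists_map_eq_one_of_mem_principalUnits θ
  have hχ : ∀ i, ∀ u ∈ principalUnits F η, compCochar θ (lam i) u = 1 := fun i u hu =>
    hθ _ fun j => cochar_mem_principalUnits (lam i) hu j
  choose R hR using fun i => exists_isGammaFactor μ hϖ hψ hψ1
    (continuous_compCochar (θ := θ) (lam i)) hη (hχ i)
  refine ⟨∏ i, R i, ⟨R, hR, rfl⟩, ?_⟩
  have hev := (eventually_all.2 fun i => (hR i).eventually_eq μ hϖ hψ
    (continuous_compCochar (lam i)) (hχ i)).and (eventually_eval_prod_eq Finset.univ R)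
  obtain ⟨s₀, hs₀⟩ := (eventually_comap.1 
    ((tendsto_cpow_nhdsNE hϖ).eventually hev)).exists_forall_of_atTop
  refine ⟨s₀, fun s hs => ?_⟩
  obtain ⟨h1, h2⟩ := hs₀ s.re hs.le s rfl
  rw [h2]
  exact hΦ.hasIntegral_twist μ hϖ hρ hψ hψ1 hη hθ fun i => h1 i s rfl

end Twist

/-! ### Supports of convolutions and the pieces Φ_m -/

section Convolution

variable {F : Type*} [NontriviallyNormedField F] [IsUltrametricDist F] {n d : ℕ}
  {lam : Fin n → Fin d → ℤ} {sig : Fin d → ℤ} {η : ℝ≥0}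

theorem IsInv.conv {φ : Test (Torus F d)} (hφ : IsInv η φ.1) (Φ : Distribution (Torus F d)) :
    IsInv η (conv Φ φ) := by
  intro x k hk
  have : Test.reflect φ (x * k) = Test.reflect φ x := by
    apply Subtype.ext
    funext h
    change φ.1 (h⁻¹ * (x * k)) = φ.1 (h⁻¹ * x)
    rw [← mul_assoc, hφ _ _ hk]
  rw [SplitTorusGamma.conv, SplitTorusGamma.conv, this]

theorem hasCompactSupport_of_pRho {f : Torus F d → ℂ} {S : Set (Torus F n)} (hS : IsCompact S)
    (φ : Test (Torus F d))
    (h : ∀ x, f x ≠ 0 → ∃ t ∈ S, φ.1 ((pRho F lam t)⁻¹ * x) ≠ 0) : HasCompactSupport f := by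
  refine HasCompactSupport.intro (K := Set.image2 (fun t y => pRho F lam t * y) S (tsupport φ.1))
    ?_ fun x hx => ?_
  · rw [← Set.image_prod]
    exact (hS.prod φ.2.2).image
      (((continuous_pRho lam).comp continuous_fst).mul continuous_snd)
  · by_contra hne
    obtain ⟨t, ht, hφ⟩ := h x hne
    exact hx ⟨t, ht, _, subset_tsupport _ hφ, mul_inv_cancel_left _ _⟩

/-- Smoothness is inherited from φ. The support condition is stated for a second test function φ',
because for the Euler product it is read off from the component character rather than from φ. -/
theorem mem_Test_conv [ProperSpace F] (Φ : Distribution (Torus F d)) {φ : Test (Torus F d)}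
    (hη : 0 < η) (hφ : IsInv η φ.1) {a b : ℝ} (ha : 0 < a) (φ' : Test (Torus F d))
    (h : ∀ x, conv Φ φ x ≠ 0 → ∃ t : Torus F n, (∀ i, a ≤ ‖(t i : F)‖ ∧ ‖(t i : F)‖ ≤ b) ∧
      φ'.1 ((pRho F lam t)⁻¹ * x) ≠ 0) : conv Φ φ ∈ Test (Torus F d) :=
  ⟨(hφ.conv Φ).isLocallyConstant hη,
    hasCompactSupport_of_pRho (isCompact_pi_norm_mem_Icc (b := b) ha) φ' h⟩

theorem isInv_indicator_level (m : ℝ) {f : Torus F d → ℂ} (hf : IsInv η f) :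
    IsInv η ((level sig m).indicator f) := by
  intro x k hk
  have hiff : x * k ∈ level sig m ↔ x ∈ level sig m := by
    change ‖((char F sig (x * k) : Fˣ) : F)‖ = m ↔ ‖((char F sig x : Fˣ) : F)‖ = m
    rw [map_mul, Units.val_mul, norm_mul, norm_char_eq_one fun j => (hk j).1, mul_one]
  by_cases hx : x ∈ level sig m
  · rw [Set.indicator_of_mem hx, Set.indicator_of_mem (hiff.2 hx), hf x k hk]
  · rw [Set.indicator_of_notMem hx, Set.indicator_of_notMem (mt hiff.1 hx)]

theorem prod_norm_le_of_mem_box {R : ℝ} {t : Torus F n} (ht : t ∈ box F n R) :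
    ∏ i, ‖(t i : F)‖ ≤ max R 1 ^ n := by
  calc ∏ i, ‖(t i : F)‖ ≤ ∏ _i : Fin n, max R 1 :=
        Finset.prod_le_prod (fun i _ => norm_nonneg _) fun i _ => (ht i).trans (le_max_left _ _)
    _ = max R 1 ^ n := by simp

/-- The other n - 1 factors are at most `max R 1` each; replacing R by `max R 1` allows the exponent
n. -/
theorem le_norm_of_mem_box {R : ℝ} {t : Torus F n} (ht : t ∈ box F n R) (i : Fin n) :
    (∏ i, ‖(t i : F)‖) / max R 1 ^ n ≤ ‖(t i : F)‖ := by
  have h1 : 1 ≤ max R 1 := le_max_right _ _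
  rw [div_le_iff₀ (by positivity), ← Finset.mul_prod_erase _ _ (Finset.mem_univ i)]
  refine mul_le_mul_of_nonneg_left ?_ (norm_nonneg _)
  calc ∏ j ∈ Finset.univ.erase i, ‖(t j : F)‖ ≤ ∏ _j ∈ Finset.univ.erase i, max R 1 :=
        Finset.prod_le_prod (fun i _ => norm_nonneg _) fun i _ => (ht i).trans (le_max_left _ _)
    _ ≤ max R 1 ^ n := by
        rw [Finset.prod_const]
        exact pow_le_pow_right₀ h1 (by simp)

variable [MeasurableSpace F] [BorelSpace F] [ProperSpace F] (μ : Measure F) [μ.IsAddHaarMeasure]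
  {ψ : AddChar F Circle} {ϖ : F}

theorem IsLimitDistribution.conv_eq (hϖ : IsUniformizer ϖ) (hρ : IsAdmissible lam sig)
    (hψ : Continuous ψ) {Φ : Distribution (Torus F d)} (hΦ : IsLimitDistribution ψ μ lam Φ)
    (φ : Test (Torus F d)) {a : F} {R : ℝ} (hφ : IsInv η φ.1) (ha : ‖a‖ ≤ R)
    (hη : ‖a‖ ≤ η * R) (hψa : ψ a ≠ 1) (x : Torus F d) :
    conv Φ φ x
      = ∫ t in box F n R, φ.1 ((pRho F lam t)⁻¹ * x) * (ψ (fRho t) : ℂ) ∂omegaMeasure μ n :=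
  hΦ.apply_eq μ hϖ hρ hψ (Test.reflect φ x) (hφ.comp_inv_mul x) ha hη hψa

/-- Multiplying by the indicator of a level set of |σ| does not change the invariance radius, so the
box formula holds for Φ_m with the same R; a non-zero integral needs a point where the integrand is
non-zero. -/
theorem IsLimitDistribution.exists_of_conv_piece_ne_zero (hϖ : IsUniformizer ϖ)
    (hρ : IsAdmissible lam sig) (hψ : Continuous ψ) {Φ : Distribution (Torus F d)}
    (hΦ : IsLimitDistribution ψ μ lam Φ) (φ : Test (Torus F d)) {a : F} {R : ℝ}
    (hφ : IsInv η φ.1) (ha : ‖a‖ ≤ R) (hη : ‖a‖ ≤ η * R) (hψa : ψ a ≠ 1) {m : ℤ} {x : Torus F d}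
    (hx : conv (piece sig ϖ Φ m) φ x ≠ 0) :
    ∃ t ∈ box F n R, ∏ i, ‖(t i : F)‖ = ‖ϖ‖ ^ m ∧ φ.1 ((pRho F lam t)⁻¹ * x) ≠ 0 := by
  have h : conv (piece sig ϖ Φ m) φ x = ∫ t in box F n R,
      (level sig (‖ϖ‖ ^ m)).indicator (fun h => φ.1 (h⁻¹ * x)) (pRho F lam t) *
        (ψ (fRho t) : ℂ) ∂omegaMeasure μ n :=
    hΦ.apply_eq μ hϖ hρ hψ
      (Test.restrict (level sig (‖ϖ‖ ^ m)) (isClopen_level sig _) (Test.reflect φ x))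
      (isInv_indicator_level _ (hφ.comp_inv_mul x)) ha hη hψa
  rw [h] at hx
  by_contra hcon
  refine hx (setIntegral_eq_zero_of_forall_eq_zero fun t ht => ?_)
  by_cases hl : pRho F lam t ∈ level sig (‖ϖ‖ ^ m)
  · have hl' : ∏ i, ‖(t i : F)‖ = ‖ϖ‖ ^ m := by
      rw [← hρ.norm_char_pRho]
      exact hl
    rw [Set.indicator_of_mem hl]
    by_cases h0 : φ.1 ((pRho F lam t)⁻¹ * x) = 0
    · rw [h0, zero_mul]
    · exact absurd ⟨t, ht, hl', h0⟩ hcon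
  · rw [Set.indicator_of_notMem hl, zero_mul]

theorem IsLimitDistribution.essentiallyCompact_piece (hϖ : IsUniformizer ϖ)
    (hρ : IsAdmissible lam sig) (hψ : Continuous ψ) (hψ1 : ψ ≠ 1) {Φ : Distribution (Torus F d)}
    (hΦ : IsLimitDistribution ψ μ lam Φ) (m : ℤ) : EssentiallyCompact (piece sig ϖ Φ m) := by
  intro φ
  obtain ⟨η, hη, hφ⟩ := Test.exists_isInv φ
  obtain ⟨a, ha⟩ := AddChar.ne_one_iff.1 hψ1
  obtain ⟨R, hR⟩ := exists_radius a hη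
  have hpos : 0 < max R 1 := lt_max_of_lt_right one_pos
  refine mem_Test_conv (n := n) (lam := lam) (b := R) _ hη hφ
    (a := ‖ϖ‖ ^ m / max R 1 ^ n) (div_pos (zpow_pos hϖ.norm_pos m) (pow_pos hpos n)) φ
    fun x hx => ?_
  obtain ⟨t, ht, hm, h0⟩ :=
    hΦ.exists_of_conv_piece_ne_zero μ hϖ hρ hψ φ hφ (hR R le_rfl).1 (hR R le_rfl).2 ha hx
  exact ⟨t, fun i => ⟨hm ▸ le_norm_of_mem_box ht i, ht i⟩, h0⟩

theorem IsLimitDistribution.exists_conv_piece_eq_zero (hϖ : IsUniformizer ϖ)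
    (hρ : IsAdmissible lam sig) (hψ : Continuous ψ) (hψ1 : ψ ≠ 1) {Φ : Distribution (Torus F d)}
    (hΦ : IsLimitDistribution ψ μ lam Φ) (φ : Test (Torus F d)) :
    ∃ N : ℤ, ∀ m < N, conv (piece sig ϖ Φ m) φ = 0 := by
  obtain ⟨η, hη, hφ⟩ := Test.exists_isInv φ
  obtain ⟨a, ha⟩ := AddChar.ne_one_iff.1 hψ1
  obtain ⟨R, hR⟩ := exists_radius a hη
  obtain ⟨N, hN⟩ := pow_unbounded_of_one_lt (max R 1 ^ n) ((one_lt_inv₀ hϖ.norm_pos).2 hϖ.2.1)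
  refine ⟨-N, fun m hm => funext fun x => ?_⟩
  by_contra hx
  obtain ⟨t, ht, htm, -⟩ :=
    hΦ.exists_of_conv_piece_ne_zero μ hϖ hρ hψ φ hφ (hR R le_rfl).1 (hR R le_rfl).2 ha hx
  have h1 := prod_norm_le_of_mem_box ht
  rw [htm] at h1
  rw [← zpow_natCast _ N, inv_zpow'] at hN
  exact absurd (h1.trans_lt hN)
    (not_lt.2 (zpow_le_zpow_right_of_le_one₀ hϖ.norm_pos hϖ.2.1.le hm.le))

end Convolution

/-! ### Multiplicative translations of T_ρ -/

section Scaling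

variable {F : Type*} [NontriviallyNormedField F] [IsUltrametricDist F] {n d : ℕ}
  [MeasurableSpace F] [BorelSpace F] [ProperSpace F] (μ : Measure F) [μ.IsAddHaarMeasure]

theorem measurePreserving_mul_left_omegaMeasure (u : Torus F n) :
    MeasurePreserving (fun t => u * t) (omegaMeasure μ n)
      ((∏ i, distribHaarChar F (u i))⁻¹ • omegaMeasure μ n) := by
  have h := measurePreserving_pi (α := fun _ : Fin n => Fˣ) (β := fun _ => Fˣ)
    (fun _ => unitsMeasure μ) (fun i => (distribHaarChar F (u i))⁻¹ • unitsMeasure μ)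
    (f := fun i t => u i * t)
    fun i => measurePreserving_mul_left μ (u i)
  have e : Measure.pi (fun i => (distribHaarChar F (u i))⁻¹ • unitsMeasure μ)
      = (∏ i, distribHaarChar F (u i))⁻¹ • omegaMeasure μ n := by
    refine Measure.pi_eq fun s _ => ?_
    rw [Measure.smul_apply, omegaMeasure, Measure.pi_pi, ← Finset.prod_inv_distrib]
    simp only [Measure.smul_apply, ENNReal.smul_def, smul_eq_mul, Finset.prod_mul_distrib]
    push_cast
    rfl
  rw [← e]
  exact h

theorem measurableEmbedding_mul_left_torus (u : Torus F n) :
    MeasurableEmbedding fun t : Torus F n => u * t :=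
  (Homeomorph.mulLeft u).measurableEmbedding

theorem integral_mul_left_omegaMeasure (u : Torus F n) (g : Torus F n → ℂ) :
    ∫ t, g (u * t) ∂omegaMeasure μ n
      = ((∏ i, distribHaarChar F (u i) : ℝ≥0) : ℂ)⁻¹ * ∫ t, g t ∂omegaMeasure μ n := by
  rw [(measurePreserving_mul_left_omegaMeasure μ u).integral_comp
    (measurableEmbedding_mul_left_torus u), integral_smul_nnreal_measure]
  simp [NNReal.smul_def]

theorem integrable_of_comp_mul_left {u : Torus F n} {g : Torus F n → ℂ}
    (h : Integrable (fun t => g (u * t)) (omegaMeasure μ n)) : Integrable g (omegaMeasure μ n) := by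
  have h1 := ((measurePreserving_mul_left_omegaMeasure μ u).integrable_comp_emb
    (measurableEmbedding_mul_left_torus u)).1 h
  have hne : (∏ i, distribHaarChar F (u i))⁻¹ ≠ 0 :=
    inv_ne_zero (Finset.prod_ne_zero_iff.2 fun i _ => distribHaarChar_pos.ne')
  exact (integrable_smul_measure (c := (((∏ i, distribHaarChar F (u i))⁻¹ : ℝ≥0) : ℝ≥0∞))
    (by exact_mod_cast hne) ENNReal.coe_ne_top).1 h1

end Scaling

/-! ### The Euler product and rationality on a component -/

section ComponentFunction

variable {F : Type*} [NontriviallyNormedField F] [IsUltrametricDist F] {n d : ℕ} {ϖ : F}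

/-- The maximal compact subgroup of `T`. -/
def maximalCompact (F : Type*) [NontriviallyNormedField F] (d : ℕ) : Set (Torus F d) :=
  {x | ∀ j, ‖(x j : F)‖ = 1}

theorem mul_mem_maximalCompact_iff {k x : Torus F d} (hk : k ∈ maximalCompact F d) :
    k * x ∈ maximalCompact F d ↔ x ∈ maximalCompact F d := by
  refine forall_congr' fun j => ?_
  rw [Pi.mul_apply, Units.val_mul, norm_mul, hk j, one_mul]

/-- The function `θ⁻¹` on the maximal compact subgroup, extended by zero. -/
noncomputable def Test.componentChar [ProperSpace F] (θ : Torus F d →ₜ* ℂˣ) : Test (Torus F d) :=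
  ⟨(maximalCompact F d).indicator fun x => ((θ x : ℂˣ) : ℂ)⁻¹, by
    obtain ⟨η, hη, hθ⟩ := exists_map_eq_one_of_mem_principalUnits θ
    have hinv : IsInv η ((maximalCompact F d).indicator fun x => ((θ x : ℂˣ) : ℂ)⁻¹) := by
      intro x k hk
      have hiff := mul_mem_maximalCompact_iff (x := x) (k := k) fun j => (hk j).1
      rw [mul_comm x k]
      by_cases hx : x ∈ maximalCompact F d
      · rw [Set.indicator_of_mem hx, Set.indicator_of_mem (hiff.2 hx), map_mul, hθ k hk, one_mul]
      · rw [Set.indicator_of_notMem hx, Set.indicator_of_notMem (mt hiff.1 hx)]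
    refine ⟨hinv.isLocallyConstant hη, HasCompactSupport.intro
      (isCompact_pi_norm_mem_Icc (F := F) (d := d) (a := 1) (b := 1) one_pos) fun x hx => ?_⟩
    exact Set.indicator_of_notMem (fun h => hx fun j => ⟨(h j).ge, (h j).le⟩) _⟩

theorem Test.componentChar_apply [ProperSpace F] (θ : Torus F d →ₜ* ℂˣ) (x : Torus F d) :
    (Test.componentChar θ).1 x
      = (maximalCompact F d).indicator (fun x => ((θ x : ℂˣ) : ℂ)⁻¹) x := rfl

theorem Test.componentChar_mul [ProperSpace F] (θ : Torus F d →ₜ* ℂˣ) {k : Torus F d}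
    (hk : k ∈ maximalCompact F d) (x : Torus F d) :
    (Test.componentChar θ).1 (k * x) = ((θ k : ℂˣ) : ℂ)⁻¹ * (Test.componentChar θ).1 x := by
  have hiff := mul_mem_maximalCompact_iff (x := x) hk
  rw [Test.componentChar_apply, Test.componentChar_apply]
  by_cases hx : x ∈ maximalCompact F d
  · rw [Set.indicator_of_mem hx, Set.indicator_of_mem (hiff.2 hx), map_mul, Units.val_mul, mul_inv]
  · rw [Set.indicator_of_notMem hx, Set.indicator_of_notMem (mt hiff.1 hx), mul_zero]

/-- The translate `x ↦ φ (g⁻¹ * x)` of a test function. -/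
def Test.translate {T : Type*} [CommGroup T] [TopologicalSpace T] [IsTopologicalGroup T] (g : T)
    (φ : Test T) : Test T :=
  ⟨fun x => φ.1 (g⁻¹ * x), (Test.isLocallyConstant φ).comp_continuous (by fun_prop),
    (Test.hasCompactSupport φ).comp_homeomorph (Homeomorph.mulLeft g⁻¹)⟩

open Classical in
/-- The element of `T_ρ` with coordinates `ϖ` at the places in `S` and `1` elsewhere. -/
noncomputable def IsUniformizer.unitOn (hϖ : IsUniformizer ϖ) (S : Finset (Fin n)) : Torus F n :=
  fun i => if i ∈ S then hϖ.unit else 1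

theorem IsUniformizer.prod_norm_unitOn (hϖ : IsUniformizer ϖ) (S : Finset (Fin n)) :
    ∏ i, ‖(hϖ.unitOn S i : F)‖ = ‖ϖ‖ ^ S.card := by
  have : ∀ i, ‖(hϖ.unitOn S i : F)‖ = if i ∈ S then ‖ϖ‖ else 1 := fun i => by
    rw [IsUniformizer.unitOn]
    split_ifs
    · rw [hϖ.val_unit]
    · simp
  simp_rw [this]
  rw [Finset.prod_ite_mem, Finset.univ_inter, Finset.prod_const]

theorem IsUniformizer.prod_distribHaarChar_unitOn [MeasurableSpace F] [BorelSpace F]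
    [ProperSpace F] (hϖ : IsUniformizer ϖ) (S : Finset (Fin n)) :
    ((∏ i, distribHaarChar F (hϖ.unitOn S i) : ℝ≥0) : ℂ) = (hϖ.modulus : ℂ) ^ S.card := by
  have : ∀ i, distribHaarChar F (hϖ.unitOn S i)
      = if i ∈ S then distribHaarChar F hϖ.unit else 1 := fun i => by
    rw [IsUniformizer.unitOn]
    split_ifs
    · rfl
    · exact map_one _
  simp_rw [this]
  rw [Finset.prod_ite_mem, Finset.univ_inter, Finset.prod_const, NNReal.coe_pow]
  push_cast
  rfl

variable [ProperSpace F]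

/-- The test function `∑_S (-δ)^{|S|} P₀((∏_{i ∈ S} λᵢ(ϖ))⁻¹ x)`, where `P₀` is
`Test.componentChar θ` and `δ` is the modulus of `ϖ`; its Mellin transform is the product of the
Euler factors `1 - δ (θ|σ|^s)(λᵢ(ϖ))`. -/
noncomputable def Test.eulerProduct (hϖ : IsUniformizer ϖ) (lam : Fin n → Fin d → ℤ)
    (θ : Torus F d →ₜ* ℂˣ) : Test (Torus F d) :=
  ∑ S : Finset (Fin n), (-(hϖ.modulus : ℂ)) ^ S.card •
    Test.translate (pRho F lam (hϖ.unitOn S)) (Test.componentChar θ)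

theorem Test.eulerProduct_apply (hϖ : IsUniformizer ϖ) (lam : Fin n → Fin d → ℤ)
    (θ : Torus F d →ₜ* ℂˣ) (x : Torus F d) :
    (Test.eulerProduct hϖ lam θ).1 x = ∑ S : Finset (Fin n), (-(hϖ.modulus : ℂ)) ^ S.card *
      (Test.componentChar θ).1 ((pRho F lam (hϖ.unitOn S))⁻¹ * x) := by
  rw [Test.eulerProduct, AddSubmonoidClass.coe_finsetSum, Finset.sum_apply]
  rfl

theorem Test.inComponent_eulerProduct (hϖ : IsUniformizer ϖ) (lam : Fin n → Fin d → ℤ)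
    (θ : Torus F d →ₜ* ℂˣ) : InComponent θ (Test.eulerProduct hϖ lam θ) := by
  intro k x hk
  rw [Test.eulerProduct_apply, Test.eulerProduct_apply, Finset.mul_sum]
  refine Finset.sum_congr rfl fun S _ => ?_
  rw [mul_left_comm _ k x, Test.componentChar_mul θ hk]
  ring

/-- At 1 only S = ∅ contributes: |σ| takes the value |ϖ|^|S| at the translating element, which for S
≠ ∅ is less than 1, so that element is not in the maximal compact subgroup. -/
theorem Test.eulerProduct_ne_zero {lam : Fin n → Fin d → ℤ} {sig : Fin d → ℤ}
    (hϖ : IsUniformizer ϖ) (hρ : IsAdmissible lam sig) (θ : Torus F d →ₜ* ℂˣ) :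
    Test.eulerProduct hϖ lam θ ≠ 0 := by
  intro h
  have h1 : (Test.eulerProduct hϖ lam θ).1 1 = 0 := by
    rw [h]
    rfl
  rw [Test.eulerProduct_apply, Finset.sum_eq_single ∅] at h1
  · have he : hϖ.unitOn (∅ : Finset (Fin n)) = 1 := by
      funext i
      simp [IsUniformizer.unitOn]
    rw [he, map_one, inv_one, mul_one, Test.componentChar_apply, Set.indicator_of_mem
      (fun j => by simp)] at h1
    simp at h1
  · intro S _ hS
    rw [Test.componentChar_apply, Set.indicator_of_notMem, mul_zero]
    intro hmem
    have h2 := norm_char_eq_one (sig := sig) hmem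
    rw [mul_one, map_inv, Units.val_inv_eq_inv_val, norm_inv, hρ.norm_char_pRho,
      hϖ.prod_norm_unitOn, inv_eq_one] at h2
    have := pow_lt_one₀ hϖ.norm_pos.le hϖ.2.1 (Finset.card_ne_zero.2
      (Finset.nonempty_iff_ne_empty.2 hS))
    exact this.ne h2
  · exact fun h => absurd (Finset.mem_univ _) h

theorem Test.isInv_componentChar {θ : Torus F d →ₜ* ℂˣ} {η : ℝ≥0}
    (hθ : ∀ k : Torus F d, (∀ j, k j ∈ principalUnits F η) → θ k = 1) :
    IsInv η (Test.componentChar θ).1 := by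
  intro x k hk
  rw [mul_comm x k, Test.componentChar_mul θ fun j => (hk j).1, hθ k hk]
  simp

theorem Test.isInv_eulerProduct (hϖ : IsUniformizer ϖ) (lam : Fin n → Fin d → ℤ)
    {θ : Torus F d →ₜ* ℂˣ} {η : ℝ≥0}
    (hθ : ∀ k : Torus F d, (∀ j, k j ∈ principalUnits F η) → θ k = 1) :
    IsInv η (Test.eulerProduct hϖ lam θ).1 := by
  intro x k hk
  rw [Test.eulerProduct_apply, Test.eulerProduct_apply]
  refine Finset.sum_congr rfl fun S _ => ?_
  rw [← mul_assoc, Test.isInv_componentChar hθ _ k hk]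

variable [MeasurableSpace F] [BorelSpace F] (μ : Measure F) [μ.IsAddHaarMeasure]
  {ψ : AddChar F Circle} {lam : Fin n → Fin d → ℤ} {sig : Fin d → ℤ}

/-- The function `ψ` on `{t | |t| ≤ R}`, extended by zero. -/
noncomputable def truncChar (ψ : AddChar F Circle) (R : ℝ) (t : Fˣ) : ℂ :=
  {t : Fˣ | ‖(t : F)‖ ≤ R}.indicator (fun t => (ψ (t : F) : ℂ)) t

theorem truncChar_sub_eq_zero {R ε : ℝ} (hϖ : IsUniformizer ϖ)
    (hε : ∀ x : F, ‖x‖ ≤ ε → ψ x = 1) {t : Fˣ} (ht : ‖(t : F)‖ < ‖ϖ‖ * min R ε) :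
    truncChar ψ R t - truncChar ψ R (hϖ.unit⁻¹ * t) = 0 := by
  have h0 := hϖ.norm_pos
  have h2 : ‖((hϖ.unit⁻¹ * t : Fˣ) : F)‖ ≤ min R ε := by
    rw [Units.val_mul, norm_mul, Units.val_inv_eq_inv_val, norm_inv, hϖ.val_unit,
      inv_mul_le_iff₀ h0]
    exact ht.le
  have h1 : ‖(t : F)‖ ≤ min R ε := by
    have hpos : 0 < min R ε := by
      by_contra hcon
      nlinarith [norm_nonneg (t : F)]
    nlinarith [hϖ.2.1]
  rw [truncChar, truncChar, Set.indicator_of_mem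
    (show t ∈ {t : Fˣ | ‖(t : F)‖ ≤ R} from h1.trans (min_le_left _ _)),
    Set.indicator_of_mem (show hϖ.unit⁻¹ * t ∈ {t : Fˣ | ‖(t : F)‖ ≤ R} from
      h2.trans (min_le_left _ _)), hε _ (h1.trans (min_le_right _ _)),
    hε _ (h2.trans (min_le_right _ _)), sub_self]

theorem truncChar_sub_eq_zero_of_lt {R : ℝ} (hϖ : IsUniformizer ϖ) {t : Fˣ}
    (ht : R < ‖(t : F)‖) : truncChar ψ R t - truncChar ψ R (hϖ.unit⁻¹ * t) = 0 := by
  have h0 := hϖ.norm_pos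
  have h2 : R < ‖((hϖ.unit⁻¹ * t : Fˣ) : F)‖ := by
    rw [Units.val_mul, norm_mul, Units.val_inv_eq_inv_val, norm_inv, hϖ.val_unit,
      lt_inv_mul_iff₀ h0]
    have := norm_pos_iff.2 t.ne_zero
    rcases le_or_gt R 0 with hR | hR
    · nlinarith
    · nlinarith [hϖ.2.1]
  rw [truncChar, truncChar, Set.indicator_of_notMem
    (show t ∉ {t : Fˣ | ‖(t : F)‖ ≤ R} from not_le.2 ht),
    Set.indicator_of_notMem (show hϖ.unit⁻¹ * t ∉ {t : Fˣ | ‖(t : F)‖ ≤ R} from not_le.2 h2),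
    sub_self]

theorem prod_truncChar (R : ℝ) (t : Torus F n) :
    ∏ i, truncChar ψ R (t i) = (box F n R).indicator (fun t => (ψ (fRho t) : ℂ)) t := by
  simp_rw [coe_addChar_fRho]
  exact prod_indicator_norm_le R (fun _ t => (ψ (t : F) : ℂ)) t

/-- In the term of S, the substitution by the element `unitOn S` moves the translation from the
component character to the truncated ψ, with Jacobian δ^|S|. This is what the coefficients (-δ)^|S|
are chosen for: the sum over S becomes the expansion of a product of differences. -/
theorem IsLimitDistribution.conv_eulerProduct (hϖ : IsUniformizer ϖ) (hρ : IsAdmissible lam sig)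
    (hψ : Continuous ψ) {Φ : Distribution (Torus F d)} (hΦ : IsLimitDistribution ψ μ lam Φ)
    {θ : Torus F d →ₜ* ℂˣ} {η : ℝ≥0}
    (hθ : ∀ k : Torus F d, (∀ j, k j ∈ principalUnits F η) → θ k = 1) {a : F} {R : ℝ}
    (ha : ‖a‖ ≤ R) (hη : ‖a‖ ≤ η * R) (hψa : ψ a ≠ 1) (x : Torus F d) :
    conv Φ (Test.eulerProduct hϖ lam θ) x
      = ∫ t, (Test.componentChar θ).1 ((pRho F lam t)⁻¹ * x) *
          ∏ i, (truncChar ψ R (t i) - truncChar ψ R (hϖ.unit⁻¹ * t i)) ∂omegaMeasure μ n := by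
  classical
  set P₀ := Test.componentChar θ with hP₀
  set δ : ℂ := (hϖ.modulus : ℂ) with hδ
  have hδ0 : δ ≠ 0 := Complex.ofReal_ne_zero.2 hϖ.modulus_pos.ne'
  have hB := (isClosed_box (F := F) (n := n) R).measurableSet
  -- The term of S in the expansion of the product of differences. Its pullback under multiplication
  -- by `unitOn S` is, up to sign, the box integrand of the term of S in the Euler product.
  let G : Finset (Fin n) → Torus F n → ℂ := fun S t => P₀.1 ((pRho F lam t)⁻¹ * x) *
    ((∏ i ∈ S, -truncChar ψ R (hϖ.unit⁻¹ * t i)) * ∏ i ∈ Finset.univ \ S, truncChar ψ R (t i))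
  have hG : ∀ S t, G S (hϖ.unitOn S * t) = (-1) ^ S.card * (box F n R).indicator (fun t =>
      P₀.1 ((pRho F lam (hϖ.unitOn S))⁻¹ * ((pRho F lam t)⁻¹ * x)) * (ψ (fRho t) : ℂ)) t := by
    intro S t
    have e1 : ∀ i ∈ S, -truncChar ψ R (hϖ.unit⁻¹ * (hϖ.unitOn S * t) i)
        = -1 * truncChar ψ R (t i) := fun i hi => by
      rw [Pi.mul_apply, IsUniformizer.unitOn, if_pos hi, inv_mul_cancel_left, neg_one_mul]
    have e2 : ∀ i ∈ Finset.univ \ S, truncChar ψ R ((hϖ.unitOn S * t) i)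
        = truncChar ψ R (t i) := fun i hi => by
      rw [Pi.mul_apply, IsUniformizer.unitOn, if_neg (Finset.mem_sdiff.1 hi).2, one_mul]
    have e3 : (∏ i ∈ S, truncChar ψ R (t i)) * ∏ i ∈ Finset.univ \ S, truncChar ψ R (t i)
        = (box F n R).indicator (fun t => (ψ (fRho t) : ℂ)) t := by
      rw [mul_comm, Finset.prod_sdiff (Finset.subset_univ S), prod_truncChar]
    simp only [G]
    rw [Finset.prod_congr rfl e1, Finset.prod_congr rfl e2, Finset.prod_mul_distrib,
      Finset.prod_const, mul_assoc ((-1) ^ S.card), e3, map_mul, mul_inv, mul_assoc, mul_left_comm]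
    congr 1
    by_cases ht : t ∈ box F n R
    · rw [Set.indicator_of_mem ht, Set.indicator_of_mem ht]
    · rw [Set.indicator_of_notMem ht, Set.indicator_of_notMem ht, mul_zero]
  have hint : ∀ S : Finset (Fin n), IntegrableOn (fun t : Torus F n =>
      P₀.1 ((pRho F lam (hϖ.unitOn S))⁻¹ * ((pRho F lam t)⁻¹ * x)) * (ψ (fRho t) : ℂ))
      (box F n R) (omegaMeasure μ n) := fun S =>
    (integrableOn_pairing μ hϖ hρ hψ
      (Test.reflect (Test.translate (pRho F lam (hϖ.unitOn S)) P₀) x) R).mono_set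
      fun t ht => norm_fRho_le_of_mem_box ((norm_nonneg a).trans ha) ht
  have hGint : ∀ S, Integrable (G S) (omegaMeasure μ n) := fun S => by
    refine integrable_of_comp_mul_left μ (u := hϖ.unitOn S) ?_
    simp_rw [hG]
    exact ((integrable_indicator_iff hB).2 (hint S)).const_mul _
  have hGval : ∀ S, ∫ t, G S t ∂omegaMeasure μ n = (-δ) ^ S.card *
      ∫ t in box F n R, P₀.1 ((pRho F lam (hϖ.unitOn S))⁻¹ * ((pRho F lam t)⁻¹ * x)) *
        (ψ (fRho t) : ℂ) ∂omegaMeasure μ n := fun S => by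
    have h := integral_mul_left_omegaMeasure μ (hϖ.unitOn S) (G S)
    simp_rw [hG] at h
    rw [integral_const_mul, integral_indicator hB, hϖ.prod_distribHaarChar_unitOn, ← hδ,
      eq_inv_mul_iff_mul_eq₀ (pow_ne_zero _ hδ0)] at h
    rw [← h, ← mul_assoc, neg_pow δ, mul_comm (δ ^ S.card)]
  rw [hΦ.conv_eq μ hϖ hρ hψ _ (Test.isInv_eulerProduct hϖ lam hθ) ha hη hψa]
  have hsum : ∀ t : Torus F n, (Test.eulerProduct hϖ lam θ).1 ((pRho F lam t)⁻¹ * x) *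
      (ψ (fRho t) : ℂ) = ∑ S : Finset (Fin n), (-δ) ^ S.card *
        (P₀.1 ((pRho F lam (hϖ.unitOn S))⁻¹ * ((pRho F lam t)⁻¹ * x)) * (ψ (fRho t) : ℂ)) := by
    intro t
    rw [Test.eulerProduct_apply, Finset.sum_mul]
    exact Finset.sum_congr rfl fun S _ => mul_assoc _ _ _
  simp_rw [hsum]
  rw [integral_finsetSum _ fun S _ => (hint S).const_mul _]
  simp_rw [integral_const_mul, ← hGval]
  rw [← integral_finsetSum _ fun S _ => hGint S]
  refine integral_congr_ae (Eventually.of_forall fun t => ?_)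
  simp only [G]
  rw [← Finset.mul_sum, ← Finset.powerset_univ, ← Finset.prod_add]
  congr 1
  exact Finset.prod_congr rfl fun i _ => by ring

/-- Each difference vanishes where |t_i| is small, both values being 1, and where |t_i| > R, both
being 0. So t stays in a compact subset of T_ρ. -/
theorem IsLimitDistribution.conv_eulerProduct_mem (hϖ : IsUniformizer ϖ)
    (hρ : IsAdmissible lam sig) (hψ : Continuous ψ) (hψ1 : ψ ≠ 1) {Φ : Distribution (Torus F d)}
    (hΦ : IsLimitDistribution ψ μ lam Φ) (θ : Torus F d →ₜ* ℂˣ) :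
    conv Φ (Test.eulerProduct hϖ lam θ) ∈ Test (Torus F d) := by
  obtain ⟨η, hη, hθ⟩ := exists_map_eq_one_of_mem_principalUnits θ
  obtain ⟨a, ha⟩ := AddChar.ne_one_iff.1 hψ1
  obtain ⟨R₀, hR₀⟩ := exists_radius a hη
  obtain ⟨ε, hε, hε1⟩ := exists_addChar_eq_one hψ
  set R := max R₀ 1
  have hR := hR₀ R (le_max_left _ _)
  have hR0 : 0 < R := lt_max_of_lt_right one_pos
  refine mem_Test_conv (n := n) (lam := lam) (a := ‖ϖ‖ * min R ε) (b := R) _ hη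
    (Test.isInv_eulerProduct hϖ lam hθ) (mul_pos hϖ.norm_pos (lt_min hR0 hε))
    (Test.componentChar θ) fun x hx => ?_
  rw [hΦ.conv_eulerProduct μ hϖ hρ hψ hθ hR.1 hR.2 ha] at hx
  by_contra hcon
  refine hx (integral_eq_zero_of_ae (Eventually.of_forall fun t => ?_))
  rw [Pi.zero_apply]
  by_contra hne
  refine hcon ⟨t, fun i => ?_, left_ne_zero_of_mul hne⟩
  have hi := Finset.prod_ne_zero_iff.1 (right_ne_zero_of_mul hne) i (Finset.mem_univ i)
  constructor
  · by_contra hlt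
    exact hi (truncChar_sub_eq_zero hϖ hε1 (not_le.1 hlt))
  · by_contra hlt
    exact hi (truncChar_sub_eq_zero_of_lt hϖ (not_le.1 hlt))

theorem IsLimitDistribution.isSigmaRegular (hϖ : IsUniformizer ϖ)
    (hρ : IsAdmissible lam sig) (hψ : Continuous ψ) (hψ1 : ψ ≠ 1) {Φ : Distribution (Torus F d)}
    (hΦ : IsLimitDistribution ψ μ lam Φ) : IsSigmaRegular sig ϖ Φ where
  essentiallyCompact := hΦ.essentiallyCompact_piece μ hϖ hρ hψ hψ1
  laurent := hΦ.exists_conv_piece_eq_zero μ hϖ hρ hψ hψ1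
  rational θ := ⟨Test.eulerProduct hϖ lam θ, Test.eulerProduct_ne_zero hϖ hρ θ,
    Test.inComponent_eulerProduct hϖ lam θ, hΦ.conv_eulerProduct_mem μ hϖ hρ hψ hψ1 θ⟩

end ComponentFunction

end SplitTorusGamma

theorem mainTheorem6 {F : Type*} [NontriviallyNormedField F] [IsUltrametricDist F]
    [LocallyCompactSpace F] [MeasurableSpace F] [BorelSpace F]
    (μ : MeasureTheory.Measure F) [μ.IsAddHaarMeasure]
    (ψ : AddChar F Circle) (hψ : Continuous ψ) (hψ1 : ψ ≠ 1)
    (ϖ : F) (hϖ : SplitTorusGamma.IsUniformizer ϖ)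
    {n d : ℕ} (lam : Fin n → Fin d → ℤ) (sig : Fin d → ℤ)
    (hρ : SplitTorusGamma.IsAdmissible lam sig) :
    (∀ (r : ℝ), 0 ≤ r → ∀ C : Set (SplitTorusGamma.Torus F d), IsOpen C → IsCompact C →
      MeasureTheory.IntegrableOn
        (fun t : SplitTorusGamma.Torus F n => (ψ (SplitTorusGamma.fRho t) : ℂ))
        (SplitTorusGamma.truncSet lam C r) (SplitTorusGamma.omegaMeasure μ n)) ∧
    (∃! Φ : SplitTorusGamma.Distribution (SplitTorusGamma.Torus F d),
      SplitTorusGamma.IsLimitDistribution ψ μ lam Φ) ∧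
    ∀ Φ : SplitTorusGamma.Distribution (SplitTorusGamma.Torus F d),
      SplitTorusGamma.IsLimitDistribution ψ μ lam Φ →
      (∀ θ : SplitTorusGamma.Torus F d →ₜ* ℂˣ, ∃ R : RatFunc ℂ,
        SplitTorusGamma.IsTorusGamma ψ μ ϖ lam θ R ∧
        ∃ s₀ : ℝ, ∀ s : ℂ, s₀ < s.re → ∀ x : SplitTorusGamma.Torus F d,
          SplitTorusGamma.HasIntegral Φ
            (fun h => SplitTorusGamma.twist sig θ s (x * h))
            (R.eval (RingHom.id ℂ) ((‖ϖ‖ : ℂ) ^ s) * SplitTorusGamma.twist sig θ s x) ∧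
          SplitTorusGamma.HasIntegral Φ
            (fun h => (SplitTorusGamma.twist sig θ s (h⁻¹ * x))⁻¹)
            (R.eval (RingHom.id ℂ) ((‖ϖ‖ : ℂ) ^ s) * (SplitTorusGamma.twist sig θ s x)⁻¹)) ∧
      SplitTorusGamma.IsSigmaRegular sig ϖ Φ := by
  have : ProperSpace F := .of_locallyCompactSpace F
  refine ⟨fun r _ C ho hc => ?_, ?_, fun Φ hΦ => ⟨fun θ => ?_,
    hΦ.isSigmaRegular μ hϖ hρ hψ hψ1⟩⟩
  · refine Measure.integrableOn_of_bounded (M := 1)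
      (SplitTorusGamma.omegaMeasure_truncSet_lt_top μ hϖ hρ hc r).ne
      (continuous_induced_dom.comp
        (hψ.comp SplitTorusGamma.continuous_fRho)).measurable.aestronglyMeasurable
      (Filter.Eventually.of_forall fun t => (Circle.norm_coe _).le)
  · obtain ⟨Φ, hΦ, huniq, -⟩ :=
      SplitTorusGamma.existsUnique_isLimitDistribution μ hϖ hρ hψ hψ1
    exact ⟨Φ, hΦ, huniq⟩
  · obtain ⟨R, hR, s₀, hs₀⟩ := hΦ.exists_isTorusGamma μ hϖ hρ hψ hψ1 θ
    refine ⟨R, hR, s₀, fun s hs x => ⟨?_, ?_⟩⟩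
    · have h := (hs₀ s hs).const_mul
        (SplitTorusGamma.twist_ne_zero (sig := sig) (θ := θ) (s := s) x)
      simp_rw [SplitTorusGamma.twist_mul]
      rwa [mul_comm] at h
    · have h := (hs₀ s hs).const_mul
        (inv_ne_zero (SplitTorusGamma.twist_ne_zero (sig := sig) (θ := θ) (s := s) x))
      -- As θ|σ|^s is multiplicative, both integrands are constant multiples of θ|σ|^s itself, and
      -- the case x = 1 suffices.
      have e : ∀ y, (SplitTorusGamma.twist sig θ s (y⁻¹ * x))⁻¹
          = (SplitTorusGamma.twist sig θ s x)⁻¹ * SplitTorusGamma.twist sig θ s y := fun y => by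
        rw [SplitTorusGamma.twist_mul, mul_inv, SplitTorusGamma.twist_inv, mul_comm]
      simp_rw [e]
      rwa [mul_comm] at h
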